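/- Let $K_0=\mathbf F_2(x_0)$ be the rational function field and, for $i\ge 1$, let $K_i=K_{i-1}(x_i)=\mathbf F_2(x_0,\dots,x_i)$, where $x_i$ is a solution, in a fixed algebraic closure of $K_0$, of $$x_i^2+x_i=x_{i-1}+1+\frac1{x_{i-1}}.$$ Let $C_i$ be the smooth projective curve over $\mathbf F_2$ with function field $K_i$, so that $C_0=\mathbf P^1$ with affine coordinate $x_0$, and consider the covers $\cdots\to C_i\to C_{i-1}\to\cdots\to C_0$ given by the inclusions $K_{i-1}\subset K_i$. The functions $x_0,\dots,x_i$ take values in $\mathbf P^1(\mathbf F_8)=\mathbf F_8\cup\{\infty\}$ at the points of $C_i(\mathbf F_8)$. Then for every $i\ge 1$ the cover $C_i\to C_0$ has degree $2^i$, and $$\#C_i(\mathbf F_8)=6\cdot 2^i+2 .$$ More precisely, for each $a\in\mathbf F_8\setminus\mathbf F_2$ the point $x_0=a$ of $C_0(\mathbf F_8)$ splits completely in $C_i\to C_0$, i.e. there are exactly $2^i$ points of $C_i(\mathbf F_8)$ above it. The points of $C_i(\mathbf F_8)$ with $x_0\notin\mathbf F_8\setminus\mathbf F_2$ are exactly two: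 a point $P(0,\infty,\dots,\infty)$, at which $(x_0,x_1,\dots,x_i)=(0,\infty,\dots,\infty)$, and a point $P(\infty,\dots,\infty)$, at which $(x_0,\dots,x_i)=(\infty,\dots,\infty)$; both are totally ramified in $C_i\to C_0$, i.e. have ramification index $2^i$. -/

import Mathlib

noncomputable section

namespace ArtinSchreierTower

/-- An algebraic closure of the rational function field `𝔽₂(x₀)`; the whole tower of function
fields is realized inside it. -/
abbrev Ambient : Type := AlgebraicClosure (RatFunc (ZMod 2))

/-- The Artin–Schreier equation `y² + y = z + 1 + 1/z` can be solved in the ambient field. -/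
theorem exists_next (z : Ambient) : ∃ y : Ambient, y ^ 2 + y = z + 1 + 1 / z := by
  let p : Polynomial Ambient :=
    Polynomial.X ^ 2 + Polynomial.X - Polynomial.C (z + 1 + 1 / z)
  have hp : p.degree = 2 := by
    dsimp only [p]
    compute_degree!
  obtain ⟨y, hy⟩ := IsAlgClosed.exists_root p (by rw [hp]; decide)
  refine ⟨y, ?_⟩
  have h : y ^ 2 + y - (z + 1 + 1 / z) = 0 := by
    simpa [p, Polynomial.IsRoot] using hy
  exact sub_eq_zero.mp h

/-- The coordinate functions: `x₀` is the variable of `𝔽₂(x₀)`, and `xₙ₊₁` is a solution of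
`xₙ₊₁² + xₙ₊₁ = xₙ + 1 + 1/xₙ`. -/
def x : ℕ → Ambient
  | 0 => algebraMap (RatFunc (ZMod 2)) Ambient RatFunc.X
  | n + 1 => Classical.choose (exists_next (x n))

theorem x_zero : x 0 = algebraMap (RatFunc (ZMod 2)) Ambient RatFunc.X := rfl

theorem x_succ (n : ℕ) : x (n + 1) ^ 2 + x (n + 1) = x n + 1 + 1 / x n :=
  Classical.choose_spec (exists_next (x n))

/-- The function field `𝔽₂(Cᵢ) = 𝔽₂(x₀, x₁, …, xᵢ)` of the curve `Cᵢ`. -/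
def functionField (i : ℕ) : IntermediateField (RatFunc (ZMod 2)) Ambient :=
  IntermediateField.adjoin (RatFunc (ZMod 2)) (x '' Set.Iic i)

theorem functionField_mono {l i : ℕ} (h : l ≤ i) : functionField l ≤ functionField i :=
  IntermediateField.adjoin.mono _ _ _ (Set.image_mono (Set.Iic_subset_Iic.mpr h))

/-- The pull back of rational functions `𝔽₂(C_l) → 𝔽₂(Cᵢ)`, for `l ≤ i`. -/
def pullback {l i : ℕ} (h : l ≤ i) : functionField l →+* functionField i :=
  (IntermediateField.inclusion (functionField_mono h)).toRingHom

/-- The coordinate `xⱼ` as a rational function on `Cᵢ`, for `0 ≤ j ≤ i`. -/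
def coordFun (i : ℕ) (j : Fin (i + 1)) : functionField i :=
  ⟨x j, IntermediateField.subset_adjoin _ _ ⟨j, Nat.lt_succ_iff.mp j.isLt, rfl⟩⟩

/-- The degree `[𝔽₂(Cᵢ) : 𝔽₂(C_l)]` of the cover `Cᵢ → C_l`, for `l ≤ i`. -/
def coverDegree (l i : ℕ) : ℕ := (functionField l).relfinrank (functionField i)

/-- The smooth projective curve `Cᵢ` over `𝔽₂`, in its incarnation as the abstract nonsingular
curve of its function field: the closed points are the places, that is, the nontrivial valuation
rings of `𝔽₂(Cᵢ)`, each being the local ring of the curve at the corresponding point. (They contain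
the field of constants `𝔽₂`, as every subring does.) -/
@[ext]
structure ClosedPoint (i : ℕ) where
  /-- The local ring of the curve at the point. -/
  localRing : ValuationSubring (functionField i)
  ne_top : localRing ≠ ⊤

theorem comap_ne_top {l i : ℕ} (h : l ≤ i) (O : ValuationSubring (functionField i))
    (hO : O ≠ ⊤) : O.comap (pullback h) ≠ ⊤ := by
  intro htop
  apply hO
  rw [eq_top_iff]
  intro y _
  obtain ⟨p, hp, hpy⟩ :=
    (Algebra.IsAlgebraic.isAlgebraic (R := RatFunc (ZMod 2)) y).isIntegral
  have hmem : ∀ r : RatFunc (ZMod 2), algebraMap (RatFunc (ZMod 2)) (functionField i) r ∈ O := by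
    intro r
    have hr : algebraMap (RatFunc (ZMod 2)) (functionField l) r ∈ O.comap (pullback h) := by
      rw [htop]; trivial
    rw [ValuationSubring.mem_comap] at hr
    exact hr
  let g : RatFunc (ZMod 2) →+* O :=
    (algebraMap (RatFunc (ZMod 2)) (functionField i)).codRestrict O.toSubring hmem
  have hint : IsIntegral O y := by
    refine ⟨p.map g, hp.map g, ?_⟩
    rw [Polynomial.eval₂_map]
    exact hpy
  obtain ⟨z, hz⟩ := IsIntegrallyClosed.algebraMap_eq_of_integral hint
  rw [← hz]
  exact z.2

/-- The cover `Cᵢ → C_l` on closed points, for `l ≤ i`. -/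
def ClosedPoint.proj {l i : ℕ} (h : l ≤ i) (Q : ClosedPoint i) : ClosedPoint l where
  localRing := Q.localRing.comap (pullback h)
  ne_top := comap_ne_top h _ Q.ne_top

/-- The homomorphism from the local ring of the image of `Q` in `C_l` to the local ring of `Q`. -/
def ClosedPoint.localMap {l i : ℕ} (h : l ≤ i) (Q : ClosedPoint i) :
    (Q.proj h).localRing →+* Q.localRing :=
  (pullback h).restrict (Q.proj h).localRing.toSubring Q.localRing.toSubring fun _ ha => ha

instance {l i : ℕ} (h : l ≤ i) (Q : ClosedPoint i) : IsLocalHom (Q.localMap h) where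
  map_nonunit a ha := by
    obtain ⟨b, hb⟩ := isUnit_iff_exists_inv.mp ha
    have hb' : pullback h (a : functionField l) * (b : functionField i) = 1 :=
      congrArg Subtype.val hb
    have hinv : (b : functionField i) = pullback h ((a : functionField l)⁻¹) := by
      rw [map_inv₀]
      exact eq_inv_of_mul_eq_one_right hb'
    have ha0 : (a : functionField l) ≠ 0 := by
      intro h0
      rw [h0, map_zero, zero_mul] at hb'
      exact zero_ne_one hb'
    refine isUnit_iff_exists_inv.mpr ⟨⟨(a : functionField l)⁻¹, ?_⟩, ?_⟩
    · change pullback h ((a : functionField l)⁻¹) ∈ Q.localRing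
      rw [← hinv]
      exact b.2
    · exact Subtype.ext (mul_inv_cancel₀ ha0)

/-- The ramification index of `Q` in the cover `Cᵢ → C_l`. -/
def ClosedPoint.ramificationIdx {l i : ℕ} (h : l ≤ i) (Q : ClosedPoint i) : ℕ :=
  letI : Algebra (Q.proj h).localRing Q.localRing := (Q.localMap h).toAlgebra
  Ideal.ramificationIdx' (IsLocalRing.maximalIdeal (Q.proj h).localRing)
    (IsLocalRing.maximalIdeal Q.localRing)

/-- `Q` is totally ramified in the cover `Cᵢ → C_l`. -/
def ClosedPoint.IsTotallyRamified {l i : ℕ} (h : l ≤ i) (Q : ClosedPoint i) : Prop :=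
  Q.ramificationIdx h = coverDegree l i

/-- The set `Cᵢ(F)` of points of `Cᵢ` with values in a field `F`, that is, of morphisms
`Spec F → Cᵢ` with image a closed point: a closed point together with a local homomorphism from its
local ring to `F` (equivalently, an embedding of its residue field into `F`). When `F` is finite,
these are all the morphisms `Spec F → Cᵢ`. -/
structure RationalPoint (i : ℕ) (F : Type*) [Field F] extends ClosedPoint i where
  /-- The evaluation of the functions that are regular at the point. -/
  eval : localRing →+* F
  isLocalHom_eval : IsLocalHom eval

namespace RationalPoint

variable {F : Type*} [Field F]

open Classical in
/-- The coordinate `xⱼ(P)`, an element of `ℙ¹(F) = F ∪ {∞}`. -/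
def coord {i : ℕ} (P : RationalPoint i F) (j : Fin (i + 1)) : OnePoint F :=
  if h : coordFun i j ∈ P.localRing then ((P.eval ⟨coordFun i j, h⟩ : F) : OnePoint F)
  else OnePoint.infty

/-- The map `Cᵢ(F) → C_l(F)` induced by the cover `Cᵢ → C_l`, for `l ≤ i`. -/
def proj {l i : ℕ} (h : l ≤ i) (Q : RationalPoint i F) : RationalPoint l F where
  toClosedPoint := Q.toClosedPoint.proj h
  eval := Q.eval.comp (Q.toClosedPoint.localMap h)
  isLocalHom_eval := by
    have := Q.isLocalHom_eval
    exact RingHom.isLocalHom_comp _ _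

/-- The `F`-rational point `P` of `C_l` splits completely in the cover `Cᵢ → C_l`: the number of
`F`-rational points of `Cᵢ` above `P` is the degree of the cover. -/
def SplitsCompletely {l : ℕ} (P : RationalPoint l F) {i : ℕ} (h : l ≤ i) : Prop :=
  Nat.card {Q : RationalPoint i F // Q.proj h = P} = coverDegree l i

end RationalPoint

end ArtinSchreierTower

end

open Polynomial

/-! Points of `Cᵢ` over a finite field `F` are the `F`-valued places of its function field, so the
proof follows places up the tower one quadratic step `y² + y = z + 1 + 1/z` at a time. Over the
base, each value of `x₀` in `ℙ¹(F)` determines one place.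

If `z` has a value `a` in `𝔽₈ ∖ 𝔽₂`, then `a + 1 + 1/a` has trace `Tr a + Tr 1 + Tr (1/a)`, the sum
of the powers `1, a, …, a⁶`, which is zero. The equation `c² + c = a + 1 + 1/a` therefore has two
roots in `𝔽₈`, each carrying one place (`Place.existsUnique_extension_split`). The roots again avoid
`𝔽₂`, so the splitting repeats at every level (`card_places_over_split`).

If `z` or `1/z` is a uniformizer `π`, the right side is `π + 1 + 1/π`, with a simple pole. The
extension is then ramified, with a single place above and `1/y` as uniformizer
(`Place.existsUnique_extension_ramified`). As `z + 1 + 1/z` is invariant under `z ↦ 1/z`, the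
situation reproduces itself with `1/y` for `π` (`existsUnique_place_of_ramified`). The same
ramification, for places with values in `𝔽₂`, shows that every step has degree exactly two.

If `x₀ = 1`, the equation becomes `c² + c = 1`, which has no root in `𝔽₈`. The fibres of `x₀` thus
contribute six times `2ⁱ`, then `1` for each of `0` and `∞`, and nothing for `1`. -/

/-- An `F`-valued place of a field `K`: a valuation subring with a local homomorphism to `F`. -/
structure Place (K F : Type*) [Field K] [Field F] where
  /-- The ring of functions that are regular at the place. -/
  ring : ValuationSubring K
  /-- The evaluation of regular functions. -/
  eval : ring →+* F
  isLocalHom_eval : IsLocalHom eval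

/-! ### Values of functions at a place. -/

namespace Place

variable {K L F : Type*} [Field K] [Field L] [Field F]

/-- The function `z` is regular at the place `P`, with value `c`. -/
def Val (P : Place K F) (z : K) (c : F) : Prop := ∃ h : z ∈ P.ring, P.eval ⟨z, h⟩ = c

variable {P Q : Place K F} {z w : K} {c d : F}

theorem val_coe (P : Place K F) (z : P.ring) : P.Val z (P.eval z) := ⟨z.2, rfl⟩

theorem Val.unique (h : P.Val z c) (h' : P.Val z d) : c = d := by
  obtain ⟨_, rfl⟩ := h
  obtain ⟨_, rfl⟩ := h'
  rfl

theorem Val.add (h : P.Val z c) (h' : P.Val w d) : P.Val (z + w) (c + d) := by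
  obtain ⟨hz, rfl⟩ := h
  obtain ⟨hw, rfl⟩ := h'
  exact ⟨add_mem hz hw, map_add P.eval ⟨z, hz⟩ ⟨w, hw⟩⟩

theorem Val.mul (h : P.Val z c) (h' : P.Val w d) : P.Val (z * w) (c * d) := by
  obtain ⟨hz, rfl⟩ := h
  obtain ⟨hw, rfl⟩ := h'
  exact ⟨mul_mem hz hw, map_mul P.eval ⟨z, hz⟩ ⟨w, hw⟩⟩

theorem val_zero : P.Val 0 0 := ⟨zero_mem _, map_zero P.eval⟩

theorem val_one : P.Val 1 1 := ⟨one_mem _, map_one P.eval⟩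

theorem Val.neg (h : P.Val z c) : P.Val (-z) (-c) := by
  obtain ⟨hz, rfl⟩ := h
  exact ⟨neg_mem hz, map_neg P.eval ⟨z, hz⟩⟩

theorem Val.pow (h : P.Val z c) (n : ℕ) : P.Val (z ^ n) (c ^ n) := by
  obtain ⟨hz, rfl⟩ := h
  exact ⟨pow_mem hz n, map_pow P.eval ⟨z, hz⟩ n⟩

theorem Val.ne_zero (h : P.Val z c) (hc : c ≠ 0) : z ≠ 0 := by
  rintro rfl
  exact hc (h.unique val_zero)

theorem Val.inv (h : P.Val z c) (hc : c ≠ 0) : P.Val z⁻¹ c⁻¹ := by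
  have hz0 := h.ne_zero hc
  obtain ⟨hz, rfl⟩ := h
  have := P.isLocalHom_eval
  obtain ⟨b, hb⟩ := isUnit_iff_exists_inv.mp (isUnit_of_map_unit P.eval ⟨z, hz⟩ hc.isUnit)
  have hb' : z * b = 1 := congrArg Subtype.val hb
  have hbz : (b : K) = z⁻¹ := eq_inv_of_mul_eq_one_right hb'
  refine ⟨hbz ▸ b.2, ?_⟩
  refine eq_inv_of_mul_eq_one_left ?_
  rw [← map_mul, ← map_one P.eval]
  congr 1
  exact Subtype.ext (inv_mul_cancel₀ hz0)

theorem exists_val_or_val_inv (P : Place K F) (z : K) : (∃ c, P.Val z c) ∨ P.Val z⁻¹ 0 := by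
  rcases P.ring.mem_or_inv_mem z with h | h
  · exact Or.inl ⟨_, h, rfl⟩
  · by_cases h0 : P.eval ⟨z⁻¹, h⟩ = 0
    · exact Or.inr ⟨h, h0⟩
    · have := Val.inv ⟨h, rfl⟩ h0
      rw [inv_inv] at this
      exact Or.inl ⟨_, this⟩

/-- Valuation rings are maximal for domination: a function with a pole at `P` has an inverse
vanishing at `P`, hence at `Q`, so it cannot be regular at `Q`. -/
theorem ext_of_val (h : ∀ z c, P.Val z c → Q.Val z c) : P = Q := by
  have hring : P.ring = Q.ring := by
    ext z
    refine ⟨fun hz => (h z _ ⟨hz, rfl⟩).1, fun hz => ?_⟩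
    rcases P.exists_val_or_val_inv z with ⟨c, hc⟩ | hc
    · exact hc.1
    · by_cases hz0 : z = 0
      · rw [hz0]; exact zero_mem _
      · have h1 := (h _ _ hc).mul ⟨hz, rfl⟩
        rw [inv_mul_cancel₀ hz0, zero_mul] at h1
        exact absurd (h1.unique val_one) zero_ne_one
  obtain ⟨O, e, he⟩ := P
  obtain ⟨O', e', he'⟩ := Q
  obtain rfl : O = O' := hring
  congr
  ext z
  exact ((h z _ ⟨z.2, rfl⟩).2).symm

/-- The restriction of a place along an embedding of fields. -/
def comap (f : K →+* L) (Q : Place L F) : Place K F where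
  ring := Q.ring.comap f
  eval := Q.eval.comp (f.restrict (Q.ring.comap f).toSubring Q.ring.toSubring fun _ h => h)
  isLocalHom_eval := by
    refine ⟨fun a ha => ?_⟩
    have hv : Q.Val (f a) (Q.eval ⟨f a, a.2⟩) := ⟨a.2, rfl⟩
    have hne : Q.eval ⟨f a, a.2⟩ ≠ 0 := ha.ne_zero
    have hinv := hv.inv hne
    have ha0 : (a : K) ≠ 0 := fun h0 => hv.ne_zero hne (by rw [h0, map_zero])
    rw [← map_inv₀] at hinv
    exact isUnit_iff_exists_inv.mpr
      ⟨⟨(a : K)⁻¹, hinv.1⟩, Subtype.ext (mul_inv_cancel₀ ha0)⟩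

theorem val_comap {f : K →+* L} {Q : Place L F} : (Q.comap f).Val z c ↔ Q.Val (f z) c := Iff.rfl

/-! ### Places defined by ring homomorphisms -/

section OfHom

variable {B : Type*} [CommRing B] {ι : B →+* L} {φ : B →+* F}

/-- `z` is a fraction with value `c`. -/
def FracVal (ι : B →+* L) (φ : B →+* F) (z : L) (c : F) : Prop :=
  ∃ r s, φ s ≠ 0 ∧ z * ι s = ι r ∧ c * φ s = φ r

/-- `z` is a quotient of elements with nonzero values. -/
def UnitFrac (ι : B →+* L) (φ : B →+* F) (z : L) : Prop :=
  ∃ r s, φ r ≠ 0 ∧ φ s ≠ 0 ∧ z * ι s = ι r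

/-- The ring consists of the fractions `r / s` with `φ s ≠ 0`. The hypothesis `hker` makes their
values well defined, and `hfrac` puts each `z` or its inverse in the ring. New places are built this
way, with `B` a polynomial ring. -/
theorem exists_of_hom (hker : ∀ b, ι b = 0 → φ b = 0)
    (hfrac : ∀ z : L, ∃ r s, z * ι s = ι r ∧ (φ r ≠ 0 ∨ φ s ≠ 0)) :
    ∃ Q : Place L F, ∀ b, Q.Val (ι b) (φ b) := by
  have hne : ∀ {b}, φ b ≠ 0 → ι b ≠ 0 := fun h h' => h (hker _ h')
  have huniq : ∀ {z c d}, FracVal ι φ z c → FracVal ι φ z d → c = d := by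
    rintro z c d ⟨r, s, hs, h1, h2⟩ ⟨r', s', hs', h1', h2'⟩
    have h : ι (r * s' - r' * s) = 0 := by
      simp only [map_sub, map_mul, ← h1, ← h1']; ring
    have h' := hker _ h
    simp only [map_sub, map_mul, ← h2, ← h2'] at h'
    have h'' : (c - d) * (φ s * φ s') = 0 := by rw [← h']; ring
    rcases mul_eq_zero.mp h'' with h0 | h0
    · exact sub_eq_zero.mp h0
    · exact absurd h0 (mul_ne_zero hs hs')
  have hadd : ∀ {z w c d}, FracVal ι φ z c → FracVal ι φ w d → FracVal ι φ (z + w) (c + d) := by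
    rintro z w c d ⟨r, s, hs, h1, h2⟩ ⟨r', s', hs', h1', h2'⟩
    refine ⟨r * s' + r' * s, s * s', by rw [map_mul]; exact mul_ne_zero hs hs', ?_, ?_⟩
    · simp only [map_add, map_mul, ← h1, ← h1']; ring
    · simp only [map_add, map_mul, ← h2, ← h2']; ring
  have hmul : ∀ {z w c d}, FracVal ι φ z c → FracVal ι φ w d → FracVal ι φ (z * w) (c * d) := by
    rintro z w c d ⟨r, s, hs, h1, h2⟩ ⟨r', s', hs', h1', h2'⟩
    refine ⟨r * r', s * s', by rw [map_mul]; exact mul_ne_zero hs hs', ?_, ?_⟩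
    · simp only [map_mul, ← h1, ← h1']; ring
    · simp only [map_mul, ← h2, ← h2']; ring
  have hι : ∀ b, FracVal ι φ (ι b) (φ b) := fun b => ⟨b, 1, by simp, by simp, by simp⟩
  have hneg : ∀ {z c}, FracVal ι φ z c → FracVal ι φ (-z) (-c) := by
    intro z c h
    simpa using hmul (hι (-1)) h
  let R : Subring L :=
    { carrier := {z | ∃ c, FracVal ι φ z c}
      zero_mem' := ⟨0, by simpa using hι 0⟩
      one_mem' := ⟨1, by simpa using hι 1⟩
      add_mem' := fun ⟨c, hc⟩ ⟨d, hd⟩ => ⟨c + d, hadd hc hd⟩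
      mul_mem' := fun ⟨c, hc⟩ ⟨d, hd⟩ => ⟨c * d, hmul hc hd⟩
      neg_mem' := fun ⟨c, hc⟩ => ⟨-c, hneg hc⟩ }
  have hR : ∀ {r s : B} {z : L}, z * ι s = ι r → φ s ≠ 0 → z ∈ R := fun {r s z} h hs =>
    ⟨φ r / φ s, r, s, hs, h, div_mul_cancel₀ _ hs⟩
  have hinv : ∀ {r s : B} {z : L}, z * ι s = ι r → φ r ≠ 0 → z⁻¹ * ι r = ι s := by
    intro r s z h hr
    have hz : z ≠ 0 := by
      rintro rfl
      exact hne hr (by rw [← h, zero_mul])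
    rw [← h, inv_mul_cancel_left₀ hz]
  let O : ValuationSubring L :=
    { R with
      mem_or_inv_mem' := by
        intro z
        obtain ⟨r, s, h, hr | hs⟩ := hfrac z
        · exact Or.inr (hR (hinv h hr) hr)
        · exact Or.inl (hR h hs) }
  have hO : ∀ z : O, ∃ c, FracVal ι φ z c := fun z => z.2
  choose e he using hO
  let ev : O →+* F :=
    { toFun := e
      map_zero' := huniq (he 0) (by simpa using hι 0)
      map_one' := huniq (he 1) (by simpa using hι 1)
      map_add' := fun z w => huniq (he (z + w)) (hadd (he z) (he w))
      map_mul' := fun z w => huniq (he (z * w)) (hmul (he z) (he w)) }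
  refine ⟨⟨O, ev, ⟨fun z hz => ?_⟩⟩, fun b => ⟨⟨_, hι b⟩, huniq (he _) (hι b)⟩⟩
  have hz0 : e z ≠ 0 := hz.ne_zero
  obtain ⟨r, s, hs, h1, h2⟩ := he z
  have hr : φ r ≠ 0 := by rw [← h2]; exact mul_ne_zero hz0 hs
  refine isUnit_iff_exists_inv.mpr ⟨⟨(z : L)⁻¹, hR (hinv h1 hr) hr⟩, Subtype.ext ?_⟩
  refine mul_inv_cancel₀ ?_
  intro h0
  exact hne hr (by rw [← h1, h0, zero_mul])

/-- In a fraction from `hfrac`, regularity of `z` forces `φ s ≠ 0`, so the value of `z` is dictated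
by the values on the image of `ι`. -/
theorem eq_of_hom (hfrac : ∀ z : L, ∃ r s, z * ι s = ι r ∧ (φ r ≠ 0 ∨ φ s ≠ 0))
    {Q Q' : Place L F} (h : ∀ b, Q.Val (ι b) (φ b)) (h' : ∀ b, Q'.Val (ι b) (φ b)) :
    Q = Q' := by
  refine ext_of_val fun z c hc => ?_
  obtain ⟨r, s, hz, hrs⟩ := hfrac z
  have hs : φ s ≠ 0 := by
    intro hs
    have h1 := hc.mul (h s)
    rw [hz, hs, mul_zero] at h1
    have := h1.unique (h r)
    rcases hrs with hrs | hrs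
    · exact hrs this.symm
    · exact hrs hs
  have hz' : z = ι r * (ι s)⁻¹ := by
    rw [← hz, mul_inv_cancel_right₀ ((h s).ne_zero hs)]
  have h1 := (h r).mul ((h s).inv hs)
  have h2 := (h' r).mul ((h' s).inv hs)
  rw [← hz'] at h1 h2
  rwa [hc.unique h1]

theorem UnitFrac.mul {z w : L} (hz : UnitFrac ι φ z) (hw : UnitFrac ι φ w) :
    UnitFrac ι φ (z * w) := by
  obtain ⟨r, s, hr, hs, h⟩ := hz
  obtain ⟨r', s', hr', hs', h'⟩ := hw
  refine ⟨r * r', s * s', by rw [map_mul]; exact mul_ne_zero hr hr',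
    by rw [map_mul]; exact mul_ne_zero hs hs', ?_⟩
  simp only [map_mul, ← h, ← h']; ring

theorem UnitFrac.ne_zero (hker : ∀ b, ι b = 0 → φ b = 0) {z : L} (hz : UnitFrac ι φ z) :
    z ≠ 0 := by
  obtain ⟨r, s, hr, hs, h⟩ := hz
  rintro rfl
  exact hr (hker _ (by rw [← h, zero_mul]))

theorem UnitFrac.inv (hker : ∀ b, ι b = 0 → φ b = 0) {z : L} (hz : UnitFrac ι φ z) :
    UnitFrac ι φ z⁻¹ := by
  have h0 := hz.ne_zero hker
  obtain ⟨r, s, hr, hs, h⟩ := hz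
  exact ⟨s, r, hs, hr, by rw [← h, inv_mul_cancel_left₀ h0]⟩

theorem unitFrac_of_ne_zero {b : B} (hb : φ b ≠ 0) : UnitFrac ι φ (ι b) :=
  ⟨b, 1, hb, by simp, by simp⟩

theorem UnitFrac.pow {z : L} (hz : UnitFrac ι φ z) (n : ℕ) : UnitFrac ι φ (z ^ n) := by
  induction n with
  | zero => exact ⟨1, 1, by simp, by simp, by simp⟩
  | succ n ih => rw [pow_succ]; exact ih.mul hz

theorem UnitFrac.zpow (hker : ∀ b, ι b = 0 → φ b = 0) {z : L} (hz : UnitFrac ι φ z) (n : ℤ) :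
    UnitFrac ι φ (z ^ n) := by
  obtain ⟨m, rfl | rfl⟩ := n.eq_nat_or_neg
  · rw [zpow_natCast]; exact hz.pow m
  · rw [zpow_neg, zpow_natCast]; exact (hz.pow m).inv hker

/-- The ultrametric principle: a term of strictly higher order does not affect the leading one. -/
theorem UnitFrac.add_pow_mul {z w : L} (hz : UnitFrac ι φ z) (hw : UnitFrac ι φ w) {p : B}
    (hp : φ p = 0) {k : ℕ} (hk : k ≠ 0) : UnitFrac ι φ (z + ι p ^ k * w) := by
  obtain ⟨r, s, hr, hs, h⟩ := hz
  obtain ⟨r', s', hr', hs', h'⟩ := hw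
  refine ⟨r * s' + p ^ k * r' * s, s * s', ?_, by rw [map_mul]; exact mul_ne_zero hs hs', ?_⟩
  · simp only [map_add, map_mul, map_pow, hp, zero_pow hk, zero_mul, add_zero]
    exact mul_ne_zero hr hs'
  · simp only [map_add, map_mul, map_pow, ← h, ← h']; ring

end OfHom

/-- `π` is a uniformizer at the place `P`, and the place is discrete. -/
structure IsUniformizer (P : Place K F) (π : K) : Prop where
  ne_zero : π ≠ 0
  val : P.Val π 0
  exists_eq : ∀ z, z ≠ 0 → ∃ (n : ℤ) (w : K) (c : F), c ≠ 0 ∧ P.Val w c ∧ z = π ^ n * w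

/-! ### Uniformizers for places defined by homomorphisms. -/

section Uniformizer

variable {B : Type*} [CommRing B] {ι : B →+* L} {φ : B →+* F}

theorem frac_of_uniformizer {p : B}
    (h : ∀ z : L, z ≠ 0 → ∃ (n : ℤ) (w : L), UnitFrac ι φ w ∧ z = ι p ^ n * w)
    (hp0 : ι p ≠ 0) (z : L) : ∃ r s, z * ι s = ι r ∧ (φ r ≠ 0 ∨ φ s ≠ 0) := by
  by_cases hz : z = 0
  · exact ⟨0, 1, by simp [hz], by simp⟩
  obtain ⟨n, w, ⟨r, s, hr, hs, hw⟩, rfl⟩ := h z hz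
  obtain ⟨m, rfl | rfl⟩ := n.eq_nat_or_neg
  · refine ⟨p ^ m * r, s, ?_, Or.inr hs⟩
    rw [zpow_natCast, map_mul, map_pow, mul_assoc, hw]
  · refine ⟨r, p ^ m * s, ?_, Or.inl hr⟩
    rw [zpow_neg, zpow_natCast, map_mul, map_pow, ← hw]
    field_simp

theorem isUniformizer_of_hom {Q : Place L F} (hQ : ∀ b, Q.Val (ι b) (φ b)) {p : B}
    (hp : φ p = 0) (hp0 : ι p ≠ 0)
    (h : ∀ z : L, z ≠ 0 → ∃ (n : ℤ) (w : L), UnitFrac ι φ w ∧ z = ι p ^ n * w) :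
    Q.IsUniformizer (ι p) := by
  refine ⟨hp0, hp ▸ hQ p, fun z hz => ?_⟩
  obtain ⟨n, w, ⟨r, s, hr, hs, hw⟩, rfl⟩ := h z hz
  refine ⟨n, w, φ r * (φ s)⁻¹, mul_ne_zero hr (inv_ne_zero hs), ?_, rfl⟩
  have h1 := (hQ r).mul ((hQ s).inv hs)
  rwa [← hw, mul_inv_cancel_right₀ ((hQ s).ne_zero hs)] at h1

end Uniformizer

end Place

namespace Place

variable {K L F : Type*} [Field K] [Field L] [Field F]

/-! ### Extension of places to quadratic extensions -/

section Quadratic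

variable {f : K →+* L} {y : L} {P : Place K F}

/-- Evaluation at `y` of the polynomials over the ring of a place. -/
def evalAt (f : K →+* L) (y : L) (P : Place K F) : P.ring[X] →+* L :=
  eval₂RingHom (f.comp P.ring.subtype) y

/-- Evaluation at `c` of the reductions of the polynomials over the ring of a place. -/
def residueEvalAt (P : Place K F) (c : F) : P.ring[X] →+* F := eval₂RingHom P.eval c

@[simp] theorem evalAt_C (a : P.ring) : evalAt f y P (C a) = f a := by simp [evalAt]

@[simp] theorem evalAt_X : evalAt f y P X = y := by simp [evalAt]

@[simp] theorem residueEvalAt_C (a : P.ring) (c : F) : residueEvalAt P c (C a) = P.eval a := by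
  simp [residueEvalAt]

@[simp] theorem residueEvalAt_X (c : F) : residueEvalAt P c X = c := by simp [residueEvalAt]

/-- Division by the monic quadratic satisfied by `y` leaves a remainder `aX + b` with `ay + b = 0`,
and `y ∉ K` forces `a = b = 0`. A relation at `y` is thus a multiple of the quadratic, which
vanishes at `c` after reduction. -/
theorem residueEvalAt_eq_zero (hy : y ∉ f.range) {s t : P.ring} (hst : y ^ 2 = f s * y + f t)
    {c : F} (hc : c ^ 2 = P.eval s * c + P.eval t) (p : P.ring[X]) (hp : evalAt f y P p = 0) :
    residueEvalAt P c p = 0 := by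
  let m : P.ring[X] := X ^ 2 - (C s * X + C t)
  have hm : m.Monic := by
    dsimp only [m]
    monicity!
  have hdeg : m.natDegree = 2 := by
    dsimp only [m]
    compute_degree!
  have hmy : evalAt f y P m = 0 := by simp [m, hst]
  have hmc : residueEvalAt P c m = 0 := by simp [m, hc]
  have hr : ∃ a b : P.ring, p %ₘ m = C a * X + C b := by
    refine exists_eq_X_add_C_of_natDegree_le_one ?_
    have := natDegree_modByMonic_lt p hm (by intro h; rw [h] at hdeg; simp at hdeg)
    omega
  obtain ⟨a, b, hab⟩ := hr
  have hdiv := modByMonic_add_div p m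
  rw [← hdiv, map_add, map_mul, hmy, zero_mul, add_zero, hab] at hp
  simp only [map_add, map_mul, evalAt_C, evalAt_X] at hp
  have ha : (a : K) = 0 := by
    by_contra ha
    refine hy ⟨-b / a, ?_⟩
    have ha' : f a ≠ 0 := (map_ne_zero f).mpr ha
    rw [map_div₀, map_neg, div_eq_iff ha']
    linear_combination -hp
  rw [ha, map_zero, zero_mul, zero_add, map_eq_zero] at hp
  have ha' : a = 0 := Subtype.ext ha
  have hb' : b = 0 := Subtype.ext hp
  rw [← hdiv, map_add, map_mul, hmc, zero_mul, hab, ha', hb']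
  simp

theorem val_evalAt {Q : Place L F} (hQ : Q.comap f = P) {c : F} (hy : Q.Val y c) (p : P.ring[X]) :
    Q.Val (evalAt f y P p) (residueEvalAt P c p) := by
  induction p using Polynomial.induction_on' with
  | add p q hp hq => rw [map_add, map_add]; exact hp.add hq
  | monomial n a =>
    rw [← C_mul_X_pow_eq_monomial, map_mul, map_mul, map_pow, map_pow, evalAt_C, evalAt_X,
      residueEvalAt_C, residueEvalAt_X]
    refine Val.mul ?_ (hy.pow n)
    rw [← val_comap, hQ]
    exact P.val_coe a

theorem existsUnique_extension (hy : y ∉ f.range) {s t : P.ring} (hst : y ^ 2 = f s * y + f t)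
    {c : F} (hc : c ^ 2 = P.eval s * c + P.eval t)
    (hfrac : ∀ z : L, ∃ p q, z * evalAt f y P q = evalAt f y P p ∧
      (residueEvalAt P c p ≠ 0 ∨ residueEvalAt P c q ≠ 0)) :
    ∃! Q : Place L F, Q.comap f = P ∧ Q.Val y c := by
  obtain ⟨Q, hQ⟩ := exists_of_hom (residueEvalAt_eq_zero hy hst hc) hfrac
  refine ⟨Q, ⟨?_, by simpa using hQ X⟩, fun Q' hQ' =>
    eq_of_hom hfrac (val_evalAt hQ'.1 hQ'.2) hQ⟩
  refine (ext_of_val fun z d hz => ?_).symm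
  obtain ⟨hz, rfl⟩ := hz
  rw [val_comap]
  simpa using hQ (C ⟨z, hz⟩)

/-- Two elements of `K` are proportional to two elements of a valuation ring, one of them `1`. -/
theorem exists_primitive (P : Place K F) (a b : K) :
    ∃ (t : K) (a' b' : P.ring), a = t * a' ∧ b = t * b' ∧ (a' = 1 ∨ b' = 1) := by
  by_cases ha : a = 0
  · exact ⟨b, 0, 1, by simp [ha], by simp, Or.inr rfl⟩
  by_cases hb : b = 0
  · exact ⟨a, 1, 0, by simp, by simp [hb], Or.inl rfl⟩
  rcases P.ring.mem_or_inv_mem (b / a) with h | h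
  · exact ⟨a, 1, ⟨b / a, h⟩, by simp, (mul_div_cancel₀ b ha).symm, Or.inl rfl⟩
  · refine ⟨b, ⟨(b / a)⁻¹, h⟩, 1, ?_, by simp, Or.inr rfl⟩
    simp only [inv_div]
    exact (mul_div_cancel₀ a hb).symm

/-- The condition `1 + 2c ≠ 0` says that the roots `c` and `-1 - c` of the reduced equation differ.
An element with primitive coefficients therefore cannot vanish at both, so either it or its
conjugate is a unit at the place `y ↦ c`. -/
theorem existsUnique_extension_split (hgen : ∀ z : L, ∃ a b, z = f a + f b * y)
    (hy : y ∉ f.range) {u : K} {d : F} (hu : P.Val u d) (hyu : y ^ 2 + y = f u)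
    {c : F} (hc : c ^ 2 + c = d) (hc2 : 1 + 2 * c ≠ 0) :
    ∃! Q : Place L F, Q.comap f = P ∧ Q.Val y c := by
  obtain ⟨hu, rfl⟩ := hu
  refine existsUnique_extension (s := -1) (t := ⟨u, hu⟩) hy ?_ ?_ fun z => ?_
  · simp only [NegMemClass.coe_neg, OneMemClass.coe_one, map_neg, map_one]
    linear_combination hyu
  · rw [map_neg, map_one]
    linear_combination hc
  obtain ⟨a₀, b₀, rfl⟩ := hgen z
  obtain ⟨t, a, b, rfl, rfl, hab⟩ := P.exists_primitive a₀ b₀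
  by_cases hw : residueEvalAt P c (C a + C b * X) = 0
  · have hσ : residueEvalAt P c (C (a - b) - C b * X) ≠ 0 := by
      simp only [map_add, map_mul, map_sub, residueEvalAt_C, residueEvalAt_X] at hw ⊢
      intro h
      have hb : P.eval b * (1 + 2 * c) = 0 := by linear_combination hw - h
      have hb := (mul_eq_zero.mp hb).resolve_right hc2
      have ha : P.eval a = 0 := by linear_combination hw - c * hb
      rcases hab with rfl | rfl
      · simp at ha
      · simp at hb
    set N : K := t * (a ^ 2 - a * b - b ^ 2 * u) with hN
    have hz : (f (t * a) + f (t * b) * y) * evalAt f y P (C (a - b) - C b * X) = f N := by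
      simp only [map_mul, map_sub, map_pow, evalAt_C, evalAt_X, hN]
      linear_combination (-(f t * (f b) ^ 2)) * hyu
    rcases P.ring.mem_or_inv_mem N with h | h
    · exact ⟨C ⟨N, h⟩, _, by rw [hz, evalAt_C], Or.inr hσ⟩
    · by_cases hN0 : N = 0
      · exact ⟨0, _, by rw [hz, hN0, map_zero, map_zero], Or.inr hσ⟩
      refine ⟨1, C ⟨N⁻¹, h⟩ * (C (a - b) - C b * X), ?_, Or.inl (by simp)⟩
      rw [map_mul (evalAt f y P), mul_left_comm, hz, evalAt_C, ← map_mul]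
      simp [hN0]
  · rcases P.ring.mem_or_inv_mem t with h | h
    · refine ⟨C ⟨t, h⟩ * (C a + C b * X), 1, ?_, Or.inr (by simp)⟩
      simp only [map_one, map_add, map_mul, evalAt_C, evalAt_X]
      ring
    · by_cases ht : t = 0
      · exact ⟨0, 1, by simp [ht], Or.inr (by simp)⟩
      refine ⟨C a + C b * X, C ⟨t⁻¹, h⟩, ?_, Or.inl hw⟩
      have ht' : f t ≠ 0 := (map_ne_zero f).mpr ht
      simp only [map_add, map_mul, evalAt_C, evalAt_X, map_inv₀]
      field_simp

/-- At a place with uniformizer `π`, the equation `y² + y = π + 1 + 1/π` has no solution, by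
comparison of the pole orders. -/
theorem IsUniformizer.sq_add_self_ne {π : K} (hπ : P.IsUniformizer π) (y : K) :
    y ^ 2 + y ≠ π + 1 + 1 / π := by
  intro h
  have hπ0 := hπ.ne_zero
  have h1 : P.Val (π ^ 2 + π + 1) 1 := by
    simpa using ((hπ.val.pow 2).add hπ.val).add val_one
  have h2 : π * (y ^ 2 + y) = π ^ 2 + π + 1 := by
    rw [h]; field_simp
  have hreg : ∀ c, ¬ P.Val y c := by
    intro c hc
    have := hπ.val.mul ((hc.pow 2).add hc)
    rw [h2, zero_mul] at this
    exact zero_ne_one (this.unique h1)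
  have hy0 : y ≠ 0 := by
    rintro rfl
    exact hreg 0 val_zero
  obtain ⟨n, w, c, hc0, hw, rfl⟩ := hπ.exists_eq y hy0
  obtain ⟨m, rfl | rfl⟩ := n.eq_nat_or_neg
  · rw [zpow_natCast] at hreg
    exact hreg _ ((hπ.val.pow m).mul hw)
  · rcases m with _ | m
    · simp only [CharP.cast_eq_zero, neg_zero, zpow_zero, one_mul] at hreg
      exact hreg _ hw
    -- Here `y = π^(-(m+1)) w`, so `y² + y` has a pole of order `2(m+1)`, never `1`. With
    -- denominators cleared, the left side has value `c² ≠ 0` and the right side has value `0`.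
    · have h3 : w ^ 2 + π ^ (m + 1) * w = π ^ (2 * m + 1) * (π ^ 2 + π + 1) := by
        rw [← h2, zpow_neg, zpow_natCast]
        field_simp
        ring
      have h4 := (hw.pow 2).add ((hπ.val.pow (m + 1)).mul hw)
      have h5 := (hπ.val.pow (2 * m + 1)).mul h1
      rw [h3] at h4
      have := h4.unique h5
      simp only [ne_eq, Nat.add_eq_zero_iff, one_ne_zero, and_false, not_false_eq_true, zero_pow,
        zero_mul, add_zero] at this
      exact hc0 (pow_eq_zero_iff two_ne_zero |>.mp this)

theorem not_val_of_ramified {π : K} (hπ : P.IsUniformizer π) (hyu : y ^ 2 + y = f (π + 1 + 1 / π))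
    {Q : Place L F} (hQ : Q.comap f = P) (c : F) : ¬ Q.Val y c := by
  intro hc
  have h1 : Q.Val (f (π ^ 2 + π + 1)) 1 := by
    rw [← val_comap, hQ]
    simpa using ((hπ.val.pow 2).add hπ.val).add val_one
  have h0 : Q.Val (f π) 0 := by
    rw [← val_comap, hQ]
    exact hπ.val
  have h2 : f π * (y ^ 2 + y) = f (π ^ 2 + π + 1) := by
    rw [hyu, ← map_mul]
    congr 1
    have := hπ.ne_zero
    field_simp
  have := h0.mul ((hc.pow 2).add hc)
  rw [h2, zero_mul] at this
  exact zero_ne_one (this.unique h1)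

/-- With `η = 1/y` the equation takes the Eisenstein form `η² = vη + v`, where `v = π/(π² + π + 1)`
vanishes at `P`; its reduction has only the root `0`. Up to a unit `π` is `η²`, so elements of `K`
have even order in `η`. -/
theorem existsUnique_extension_ramified (hgen : ∀ z : L, ∃ a b, z = f a + f b * y)
    {π : K} (hπ : P.IsUniformizer π) (hyu : y ^ 2 + y = f (π + 1 + 1 / π)) :
    (∃! Q : Place L F, Q.comap f = P) ∧
    ∀ Q : Place L F, Q.comap f = P → Q.IsUniformizer y⁻¹ ∧
      ∃ (w : L) (c : F), c ≠ 0 ∧ Q.Val w c ∧ f π = y⁻¹ ^ 2 * w := by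
  have hπ0 := hπ.ne_zero
  have hy : y ∉ f.range := by
    rintro ⟨y, rfl⟩
    rw [← map_pow, ← map_add] at hyu
    exact hπ.sq_add_self_ne y (f.injective hyu)
  have hy0 : y ≠ 0 := by
    rintro rfl
    exact hy ⟨0, map_zero f⟩
  have hy1 : y + 1 ≠ 0 := fun h =>
    hy ⟨-1, by rw [map_neg, map_one]; exact (eq_neg_of_add_eq_zero_left h).symm⟩
  have hη : y⁻¹ ∉ f.range := by
    rintro ⟨a, ha⟩
    exact hy ⟨a⁻¹, by rw [map_inv₀, ha, inv_inv]⟩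
  have he : P.Val (π ^ 2 + π + 1) 1 := by
    simpa using ((hπ.val.pow 2).add hπ.val).add val_one
  have he0 : π ^ 2 + π + 1 ≠ 0 := he.ne_zero one_ne_zero
  have hv : P.Val (π * (π ^ 2 + π + 1)⁻¹) 0 := by
    simpa using hπ.val.mul (he.inv one_ne_zero)
  have hrel : f π * (y ^ 2 + y) = f (π ^ 2 + π + 1) := by
    rw [hyu, ← map_mul]
    congr 1
    field_simp
  have hfπ : f π ≠ 0 := (map_ne_zero f).mpr hπ0
  obtain ⟨hvm, hv0⟩ := hv
  have hst : y⁻¹ ^ 2 = f (⟨_, hvm⟩ : P.ring) * y⁻¹ + f (⟨_, hvm⟩ : P.ring) := by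
    simp only [map_mul, map_inv₀, ← hrel]
    field_simp
    ring
  have hc : (0 : F) ^ 2 = P.eval ⟨_, hvm⟩ * 0 + P.eval ⟨_, hvm⟩ := by rw [hv0]; simp
  have hker := residueEvalAt_eq_zero hη hst hc
  let ι := evalAt f y⁻¹ P
  let φ := residueEvalAt P (0 : F)
  have hX : ι X = y⁻¹ := evalAt_X
  have hφX : φ X = 0 := residueEvalAt_X 0
  have hunit : ∀ {w c}, c ≠ 0 → P.Val w c → UnitFrac ι φ (f w) := by
    rintro w c hc0 ⟨hw, rfl⟩
    have : UnitFrac ι φ (ι (C ⟨w, hw⟩)) := unitFrac_of_ne_zero (by simpa [φ] using hc0)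
    simpa [ι] using this
  have hπη : ∃ w, UnitFrac ι φ w ∧ f π = y⁻¹ ^ 2 * w := by
    have h1 : UnitFrac ι φ (ι (1 + X)) := unitFrac_of_ne_zero (by simp [φ])
    refine ⟨_, (hunit one_ne_zero he).mul (h1.inv hker), ?_⟩
    have h1y : ι (1 + X) = 1 + y⁻¹ := by simp [ι]
    rw [h1y, ← hrel]
    field_simp
  obtain ⟨ω, hω, hπω⟩ := hπη
  have hf : ∀ a : K, a ≠ 0 → ∃ (n : ℤ) (w : L), UnitFrac ι φ w ∧ f a = y⁻¹ ^ (2 * n) * w := by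
    intro a ha
    obtain ⟨n, w, c, hc0, hw, rfl⟩ := hπ.exists_eq a ha
    refine ⟨n, ω ^ n * f w, (hω.zpow hker n).mul (hunit hc0 hw), ?_⟩
    rw [map_mul, map_zpow₀, hπω, mul_zpow, zpow_mul, mul_assoc]
    norm_cast
  have hsum : ∀ (m n : ℤ) (w w' : L), m < n → UnitFrac ι φ w → UnitFrac ι φ w' →
      ∃ (k : ℤ) (v : L), UnitFrac ι φ v ∧ y⁻¹ ^ m * w + y⁻¹ ^ n * w' = y⁻¹ ^ k * v := by
    intro m n w w' hmn hw hw'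
    obtain ⟨k, hk⟩ := Int.eq_ofNat_of_zero_le (sub_nonneg.mpr hmn.le)
    refine ⟨m, w + ι X ^ k * w', hw.add_pow_mul hw' hφX (by omega), ?_⟩
    have hn : n = m + k := by omega
    rw [hn, hX, zpow_add₀ (inv_ne_zero hy0), zpow_natCast]
    ring
  have hall : ∀ z : L, z ≠ 0 → ∃ (n : ℤ) (w : L), UnitFrac ι φ w ∧ z = ι X ^ n * w := by
    intro z hz
    rw [hX]
    have hgen' : ∃ a b, z = f a + f b * y⁻¹ := by
      obtain ⟨a, b, rfl⟩ := hgen z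
      -- This uses `y + 1 = (y² + y) / y`.
      refine ⟨a - b, b * (π + 1 + 1 / π), ?_⟩
      rw [map_mul, ← hyu, map_sub]
      field_simp
      ring
    obtain ⟨a, b, rfl⟩ := hgen'
    by_cases ha : a = 0
    · have hb : b ≠ 0 := by
        rintro rfl
        simp [ha] at hz
      obtain ⟨n, w, hw, hb⟩ := hf b hb
      refine ⟨2 * n + 1, w, hw, ?_⟩
      rw [ha, hb, zpow_add₀ (inv_ne_zero hy0), zpow_one, map_zero]
      ring
    · obtain ⟨m, w, hw, ha⟩ := hf a ha
      by_cases hb : b = 0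
      · exact ⟨2 * m, w, hw, by rw [hb, map_zero, zero_mul, add_zero, ha]⟩
      obtain ⟨n, w', hw', hb⟩ := hf b hb
      have hb' : f b * y⁻¹ = y⁻¹ ^ (2 * n + 1) * w' := by
        rw [hb, zpow_add₀ (inv_ne_zero hy0), zpow_one]
        ring
      rw [ha, hb']
      -- The two terms have orders of opposite parity, so they cannot cancel.
      rcases lt_or_gt_of_ne (show 2 * m ≠ 2 * n + 1 by omega) with hmn | hmn
      · exact hsum _ _ _ _ hmn hw hw'
      · rw [add_comm]
        exact hsum _ _ _ _ hmn hw' hw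
  have hX0 : ι X ≠ 0 := by rw [hX]; exact inv_ne_zero hy0
  have hval : ∀ Q : Place L F, Q.comap f = P → Q.Val y⁻¹ 0 := fun Q hQ =>
    (Q.exists_val_or_val_inv y).resolve_left
      fun ⟨c, hc⟩ => not_val_of_ramified hπ hyu hQ c hc
  constructor
  · obtain ⟨Q, hQ, huniq⟩ := existsUnique_extension hη hst hc (frac_of_uniformizer hall hX0)
    exact ⟨Q, hQ.1, fun Q' hQ' => huniq Q' ⟨hQ', hval Q' hQ'⟩⟩
  · intro Q hQ
    have hQv : ∀ p, Q.Val (ι p) (φ p) := val_evalAt hQ (hval Q hQ)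
    refine ⟨hX ▸ isUniformizer_of_hom hQv hφX hX0 hall, ω, ?_⟩
    obtain ⟨r, s, hr, hs, h⟩ := hω
    refine ⟨φ r * (φ s)⁻¹, mul_ne_zero hr (inv_ne_zero hs), ?_, hπω⟩
    have h1 := (hQv r).mul ((hQv s).inv hs)
    rwa [← h, mul_inv_cancel_right₀ ((hQv s).ne_zero hs)] at h1

end Quadratic

end Place

namespace Place

variable {K L F : Type*} [Field K] [Field L] [Field F]

/-! ### Places of a rational function field -/

section Rational

variable {e : ZMod 2 →+* L} {t : L}

/-- `L` is the field of rational functions in `t` over the image of `e`. -/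
structure IsRationalFunctionField (e : ZMod 2 →+* L) (t : L) : Prop where
  injective : Function.Injective (eval₂RingHom e t)
  exists_frac : ∀ z : L, ∃ r s : (ZMod 2)[X], s ≠ 0 ∧
    z * eval₂RingHom e t s = eval₂RingHom e t r

theorem IsRationalFunctionField.ne_zero (h : IsRationalFunctionField e t) : t ≠ 0 := by
  rintro rfl
  exact X_ne_zero (h.injective (a₁ := X) (a₂ := 0) (by simp))

/-- Reversing coefficients exchanges polynomials in `t` and in `t⁻¹`. The pole of `x₀` can then be
treated as the zero of `1/x₀`. -/
theorem IsRationalFunctionField.inv (h : IsRationalFunctionField e t) :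
    IsRationalFunctionField e t⁻¹ := by
  have ht := h.ne_zero
  have hrev : ∀ p : (ZMod 2)[X], eval₂ e t⁻¹ p.reverse * t ^ p.natDegree = eval₂ e t p := by
    intro p
    let _ := invertibleOfNonzero ht
    simpa using eval₂_reverse_mul_pow e t p
  constructor
  · rw [injective_iff_map_eq_zero]
    intro p hp
    let _ := invertibleOfNonzero (inv_ne_zero ht)
    have h1 : eval₂ e t p.reverse = 0 := by
      have := (eval₂_reverse_eq_zero_iff e t⁻¹ p).mpr hp
      simpa using this
    have h2 : p.reverse = 0 := h.injective (by simpa using h1)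
    simpa using h2
  · intro z
    obtain ⟨r, s, hs, hz⟩ := h.exists_frac z
    refine ⟨r.reverse * X ^ s.natDegree, s.reverse * X ^ r.natDegree, ?_, ?_⟩
    · exact mul_ne_zero (by simpa using hs) (pow_ne_zero _ X_ne_zero)
    · simp only [coe_eval₂RingHom, ← hrev] at hz
      simp only [map_mul, map_pow, coe_eval₂RingHom, eval₂_X]
      generalize eval₂ e t⁻¹ s.reverse = s' at hz ⊢
      generalize eval₂ e t⁻¹ r.reverse = r' at hz ⊢
      rw [inv_pow, inv_pow]
      field_simp
      linear_combination hz

/-- After cancelling the gcd, a Bézout identity prevents numerator and denominator from both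
vanishing at `a`. -/
theorem IsRationalFunctionField.frac (h : IsRationalFunctionField e t) (g : ZMod 2 →+* F) (a : F)
    (z : L) : ∃ r s, z * eval₂RingHom e t s = eval₂RingHom e t r ∧
      (eval₂RingHom g a r ≠ 0 ∨ eval₂RingHom g a s ≠ 0) := by
  obtain ⟨r, s, hs, hz⟩ := h.exists_frac z
  obtain ⟨r', hr'⟩ := EuclideanDomain.gcd_dvd_left r s
  obtain ⟨s', hs'⟩ := EuclideanDomain.gcd_dvd_right r s
  have hbez := EuclideanDomain.gcd_eq_gcd_ab r s
  set d := EuclideanDomain.gcd r s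
  have hd0 : d ≠ 0 := by
    intro h0
    rw [h0, zero_mul] at hs'
    exact hs hs'
  have hcop : r' * EuclideanDomain.gcdA r s + s' * EuclideanDomain.gcdB r s = 1 := by
    refine mul_left_cancel₀ hd0 ?_
    linear_combination (-EuclideanDomain.gcdA r s) * hr' - EuclideanDomain.gcdB r s * hs' - hbez
  refine ⟨r', s', ?_, ?_⟩
  · have hd0' : eval₂RingHom e t d ≠ 0 := fun h0 => hd0 (h.injective (by rw [h0, map_zero]))
    refine mul_left_cancel₀ hd0' ?_
    rw [mul_left_comm, ← map_mul, ← map_mul, ← hr', ← hs', hz]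
  · by_contra! hcon
    have := congrArg (eval₂RingHom g a) hcop
    rw [map_add, map_mul, map_mul, hcon.1, hcon.2, map_one] at this
    simp at this

theorem val_eval₂ {Q : Place L F} {a : F} (ht : Q.Val t a) (g : ZMod 2 →+* F) (p : (ZMod 2)[X]) :
    Q.Val (eval₂RingHom e t p) (eval₂RingHom g a p) := by
  induction p using Polynomial.induction_on' with
  | add p q hp hq => rw [map_add, map_add]; exact hp.add hq
  | monomial n c =>
    simp only [coe_eval₂RingHom, eval₂_monomial]
    refine Val.mul ?_ (ht.pow n)
    obtain rfl | rfl : c = 0 ∨ c = 1 := by revert c; decide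
    · rw [map_zero, map_zero]; exact val_zero
    · rw [map_one, map_one]; exact val_one

theorem IsRationalFunctionField.existsUnique (h : IsRationalFunctionField e t)
    (g : ZMod 2 →+* F) (a : F) : ∃! Q : Place L F, Q.Val t a := by
  obtain ⟨Q, hQ⟩ := exists_of_hom (ι := eval₂RingHom e t) (φ := eval₂RingHom g a)
    (fun b hb => by
      rw [h.injective (hb.trans (map_zero _).symm), map_zero]) (h.frac g a)
  refine ⟨Q, by simpa using hQ X, fun Q' hQ' => ?_⟩
  exact eq_of_hom (h.frac g a) (val_eval₂ hQ' g) hQ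

theorem IsRationalFunctionField.isUniformizer (h : IsRationalFunctionField e t)
    (g : ZMod 2 →+* F) {Q : Place L F} (hQ : Q.Val t 0) : Q.IsUniformizer t := by
  have hker : ∀ b, eval₂RingHom e t b = 0 → eval₂RingHom g (0 : F) b = 0 := fun b hb => by
    rw [h.injective (hb.trans (map_zero _).symm), map_zero]
  have hpoly : ∀ p : (ZMod 2)[X], p ≠ 0 → ∃ (n : ℕ) (q : (ZMod 2)[X]),
      eval₂RingHom g (0 : F) q ≠ 0 ∧ p = X ^ n * q := by
    intro p hp
    obtain ⟨q, hq, hndvd⟩ := p.exists_eq_pow_rootMultiplicity_mul_and_not_dvd hp 0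
    rw [C_0, sub_zero] at hq hndvd
    refine ⟨_, q, ?_, hq⟩
    rw [X_dvd_iff] at hndvd
    simpa [coe_eval₂RingHom, eval₂_at_zero] using hndvd
  have hX : eval₂RingHom e t X = t := by simp
  have hall : ∀ z : L, z ≠ 0 → ∃ (n : ℤ) (w : L),
      UnitFrac (eval₂RingHom e t) (eval₂RingHom g 0) w ∧ z = eval₂RingHom e t X ^ n * w := by
    intro z hz
    obtain ⟨r, s, hs, hrs⟩ := h.exists_frac z
    have hs0 : eval₂RingHom e t s ≠ 0 := fun h0 => hs (h.injective (by rw [h0, map_zero]))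
    have hr : r ≠ 0 := by
      rintro rfl
      rw [map_zero] at hrs
      exact mul_ne_zero hz hs0 hrs
    obtain ⟨m, r', hr', rfl⟩ := hpoly r hr
    obtain ⟨n, s', hs', rfl⟩ := hpoly s hs
    refine ⟨m - n, _, (unitFrac_of_ne_zero hr').mul ((unitFrac_of_ne_zero hs').inv hker), ?_⟩
    have ht := h.ne_zero
    have hs0' : eval₂RingHom e t s' ≠ 0 := fun h0 => hs' (hker _ h0)
    rw [map_mul, map_mul, map_pow, map_pow, hX] at hrs
    rw [hX, zpow_sub₀ ht, zpow_natCast, zpow_natCast]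
    field_simp
    linear_combination hrs
  have := isUniformizer_of_hom (val_eval₂ (e := e) hQ g) (p := X) (by simp)
    (by rw [hX]; exact h.ne_zero) hall
  rwa [hX] at this

end Rational

/-! ### Nontriviality and maximal ideals of places. -/

/-- Over a finite field of constants, the ring of a place of an infinite field is not the whole
field. -/
theorem ring_ne_top [Infinite K] [Finite F] (P : Place K F) : P.ring ≠ ⊤ := by
  intro htop
  have hmem : ∀ z : K, z ∈ P.ring := fun z => htop ▸ ValuationSubring.mem_top z
  refine not_injective_infinite_finite (fun z : K => P.eval ⟨z, hmem z⟩) fun z w hzw => ?_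
  by_contra hne
  have h1 : P.Val (z + -w) 0 := by
    have := (P.val_coe ⟨z, hmem z⟩).add (P.val_coe ⟨w, hmem w⟩).neg
    rwa [show P.eval ⟨z, hmem z⟩ = P.eval ⟨w, hmem w⟩ from hzw, add_neg_cancel] at this
  have h2 := h1.mul (P.val_coe ⟨(z + -w)⁻¹, hmem _⟩)
  rw [mul_inv_cancel₀ (by rw [← sub_eq_add_neg]; exact sub_ne_zero.mpr hne), zero_mul] at h2
  exact zero_ne_one (h2.unique val_one)

theorem mem_maximalIdeal_iff (P : Place K F) (z : P.ring) :
    z ∈ IsLocalRing.maximalIdeal P.ring ↔ P.eval z = 0 := by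
  have := P.isLocalHom_eval
  rw [IsLocalRing.mem_maximalIdeal, mem_nonunits_iff, ← isUnit_map_iff P.eval, isUnit_iff_ne_zero,
    not_not]

theorem IsUniformizer.exists_eq_mul {P : Place K F} {π : K} (hπ : P.IsUniformizer π) {z : K}
    (hz : P.Val z 0) : ∃ w ∈ P.ring, z = π * w := by
  by_cases hz0 : z = 0
  · exact ⟨0, zero_mem _, by simp [hz0]⟩
  obtain ⟨n, w, c, hc, hw, rfl⟩ := hπ.exists_eq z hz0
  obtain ⟨m, rfl | rfl⟩ := n.eq_nat_or_neg
  · rcases m with _ | m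
    · simp only [CharP.cast_eq_zero, zpow_zero, one_mul] at hz
      exact absurd (hw.unique hz) hc
    · refine ⟨π ^ m * w, ((hπ.val.pow m).mul hw).1, ?_⟩
      rw [zpow_natCast, pow_succ]
      ring
  · have h1 := (hπ.val.pow m).mul hz
    rw [zpow_neg, zpow_natCast, mul_inv_cancel_left₀ (pow_ne_zero m hπ.ne_zero), mul_zero] at h1
    exact absurd (hw.unique h1) hc

theorem IsUniformizer.maximalIdeal_eq {P : Place K F} {π : K} (hπ : P.IsUniformizer π) :
    IsLocalRing.maximalIdeal P.ring = Ideal.span {⟨π, hπ.val.1⟩} := by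
  ext z
  rw [mem_maximalIdeal_iff, Ideal.mem_span_singleton]
  constructor
  · intro hz
    obtain ⟨w, hw, h⟩ := hπ.exists_eq_mul ⟨z.2, hz⟩
    exact ⟨⟨w, hw⟩, Subtype.ext h⟩
  · rintro ⟨w, rfl⟩
    rw [map_mul, hπ.val.2, zero_mul]

end Place

namespace ArtinSchreierTower

/-! ### The tower of function fields -/

theorem coe_pullback {l i : ℕ} (h : l ≤ i) (a : functionField l) :
    (pullback h a : Ambient) = a :=
  IntermediateField.coe_inclusion (functionField_mono h) a

theorem pullback_coordFun {l i : ℕ} (h : l ≤ i) (j : Fin (l + 1)) :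
    pullback h (coordFun l j) = coordFun i (Fin.castLE (Nat.succ_le_succ h) j) :=
  Subtype.ext (coe_pullback h _)

theorem pullback_pullback {k l i : ℕ} (h : k ≤ l) (h' : l ≤ i) (a : functionField k) :
    pullback h' (pullback h a) = pullback (h.trans h') a :=
  Subtype.ext (by simp only [coe_pullback])

theorem pullback_self {i : ℕ} (h : i ≤ i) (a : functionField i) : pullback h a = a :=
  Subtype.ext (coe_pullback h a)

theorem comap_pullback_pullback {F : Type*} [Field F] {k l i : ℕ} (h : k ≤ l) (h' : l ≤ i)
    (Q : Place (functionField i) F) :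
    (Q.comap (pullback h')).comap (pullback h) = Q.comap (pullback (h.trans h')) :=
  Place.ext_of_val fun z c hz => by
    rw [Place.val_comap, Place.val_comap, pullback_pullback] at hz
    exact Place.val_comap.mpr hz

theorem comap_pullback_self {F : Type*} [Field F] {i : ℕ} (h : i ≤ i)
    (Q : Place (functionField i) F) : Q.comap (pullback h) = Q :=
  Place.ext_of_val fun z c hz => by rwa [Place.val_comap, pullback_self] at hz

theorem coordFun_last_sq_add (i : ℕ) :
    coordFun (i + 1) (Fin.last _) ^ 2 + coordFun (i + 1) (Fin.last _) =
      pullback i.le_succ (coordFun i (Fin.last _) + 1 + 1 / coordFun i (Fin.last _)) :=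
  Subtype.ext (x_succ i)

theorem exists_eq_add_mul_x {i : ℕ} {z : Ambient} (hz : z ∈ functionField (i + 1)) :
    ∃ a ∈ functionField i, ∃ b ∈ functionField i, z = a + b * x (i + 1) := by
  have hx : ∀ j ≤ i, x j ∈ functionField i := fun j hj =>
    IntermediateField.subset_adjoin _ _ ⟨j, hj, rfl⟩
  have hz' : z ∈ Algebra.adjoin (RatFunc (ZMod 2)) (x '' Set.Iic (i + 1)) := by
    rw [← IntermediateField.adjoin_toSubalgebra_of_isAlgebraic fun w _ =>
      Algebra.IsAlgebraic.isAlgebraic w]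
    exact hz
  clear hz
  induction hz' using Algebra.adjoin_induction with
  | mem w hw =>
    obtain ⟨j, hj, rfl⟩ := hw
    rcases Nat.le_succ_iff.mp (Set.mem_Iic.mp hj) with hj | rfl
    · exact ⟨x j, hx j hj, 0, zero_mem _, by simp⟩
    · exact ⟨0, zero_mem _, 1, one_mem _, by simp⟩
  | algebraMap r => exact ⟨_, (functionField i).algebraMap_mem r, 0, zero_mem _, by simp⟩
  | add v w _ _ hv hw =>
    obtain ⟨a, ha, b, hb, rfl⟩ := hv
    obtain ⟨a', ha', b', hb', rfl⟩ := hw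
    exact ⟨a + a', add_mem ha ha', b + b', add_mem hb hb', by ring⟩
  | mul v w _ _ hv hw =>
    obtain ⟨a, ha, b, hb, rfl⟩ := hv
    obtain ⟨a', ha', b', hb', rfl⟩ := hw
    have hu : x i + 1 + 1 / x i ∈ functionField i :=
      add_mem (add_mem (hx i le_rfl) (one_mem _)) (div_mem (one_mem _) (hx i le_rfl))
    refine ⟨a * a' + b * b' * (x i + 1 + 1 / x i),
      add_mem (mul_mem ha ha') (mul_mem (mul_mem hb hb') hu), a * b' + a' * b - b * b',
      sub_mem (add_mem (mul_mem ha hb') (mul_mem ha' hb)) (mul_mem hb hb'), ?_⟩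
    linear_combination (b * b') * x_succ i

theorem exists_eq_pullback_add_mul (i : ℕ) (z : functionField (i + 1)) :
    ∃ a b, z = pullback i.le_succ a + pullback i.le_succ b * coordFun (i + 1) (Fin.last _) := by
  obtain ⟨a, ha, b, hb, h⟩ := exists_eq_add_mul_x z.2
  exact ⟨⟨a, ha⟩, ⟨b, hb⟩, Subtype.ext h⟩

theorem functionField_zero : functionField 0 = ⊥ := by
  rw [functionField, IntermediateField.adjoin_eq_bot_iff]
  rintro _ ⟨j, hj, rfl⟩
  obtain rfl : j = 0 := Nat.le_zero.mp hj
  exact IntermediateField.mem_bot.mpr ⟨_, rfl⟩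

/-- The embedding of the constants. -/
noncomputable def constHom (i : ℕ) : ZMod 2 →+* functionField i :=
  (algebraMap (RatFunc (ZMod 2)) (functionField i)).comp RatFunc.C

theorem isRationalFunctionField_zero :
    Place.IsRationalFunctionField (constHom 0) (coordFun 0 0) := by
  have hev : ∀ p : (ZMod 2)[X], eval₂RingHom (constHom 0) (coordFun 0 0) p =
      algebraMap (RatFunc (ZMod 2)) (functionField 0) (algebraMap _ (RatFunc (ZMod 2)) p) := by
    intro p
    have : eval₂RingHom (constHom 0) (coordFun 0 0) =
        (algebraMap (RatFunc (ZMod 2)) (functionField 0)).comp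
          (algebraMap (ZMod 2)[X] (RatFunc (ZMod 2))) := by
      refine Polynomial.ringHom_ext' ?_ ?_
      · exact Subsingleton.elim _ _
      · rw [coe_eval₂RingHom, eval₂_X, RingHom.comp_apply, RatFunc.algebraMap_X]
        rfl
    rw [this, RingHom.comp_apply]
  constructor
  · intro p q hpq
    rw [hev, hev] at hpq
    exact RatFunc.algebraMap_injective _ ((algebraMap _ (functionField 0)).injective hpq)
  · intro z
    have hz : (z : Ambient) ∈ (⊥ : IntermediateField (RatFunc (ZMod 2)) Ambient) :=
      functionField_zero ▸ z.2
    obtain ⟨r, hr⟩ := IntermediateField.mem_bot.mp hz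
    obtain rfl : algebraMap (RatFunc (ZMod 2)) (functionField 0) r = z := Subtype.ext hr
    refine ⟨r.num, r.denom, r.denom_ne_zero, ?_⟩
    rw [hev, hev, ← map_mul]
    congr 1
    nth_rewrite 1 [← RatFunc.num_div_denom r]
    exact div_mul_cancel₀ _ (RatFunc.algebraMap_ne_zero r.denom_ne_zero)

instance (i : ℕ) : Infinite (functionField i) :=
  have : Infinite (ZMod 2)[X] := inferInstance
  Infinite.of_injective
    (fun p : (ZMod 2)[X] => algebraMap (RatFunc (ZMod 2)) (functionField i) (algebraMap _ _ p))
    fun _ _ h => RatFunc.algebraMap_injective _ ((algebraMap _ (functionField i)).injective h)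

variable {F : Type*} [Field F]

/-- The totally ramified part of the tower. -/
theorem existsUnique_place_of_ramified {P : Place (functionField 0) F} {π : functionField 0}
    (hπ : P.IsUniformizer π) (hπx : π + 1 + 1 / π = coordFun 0 0 + 1 + 1 / coordFun 0 0) (i : ℕ) :
    (∃! Q : Place (functionField i) F, Q.comap (pullback i.zero_le) = P) ∧
    ∀ Q : Place (functionField i) F, Q.comap (pullback i.zero_le) = P →
      ∃ η : functionField i, Q.IsUniformizer η ∧
        η + 1 + 1 / η = coordFun i (Fin.last i) + 1 + 1 / coordFun i (Fin.last i) ∧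
        (∀ j, j ≠ 0 → ∀ c, ¬ Q.Val (coordFun i j) c) ∧
        ∃ w c, c ≠ 0 ∧ Q.Val w c ∧ pullback i.zero_le π = η ^ 2 ^ i * w := by
  induction i with
  | zero =>
    simp only [comap_pullback_self, existsUnique_eq, true_and]
    rintro Q rfl
    refine ⟨π, hπ, hπx, fun j hj => absurd (Subsingleton.elim (α := Fin 1) j 0) hj, 1, 1,
      one_ne_zero, Place.val_one, ?_⟩
    rw [pow_zero, pow_one, mul_one, pullback_self]
  | succ i ih =>
    obtain ⟨⟨Q₀, hQ₀, huniq⟩, hprop⟩ := ih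
    obtain ⟨η, hη, hηx, hcoord, w, c, hc, hw, hπη⟩ := hprop Q₀ hQ₀
    obtain ⟨⟨Q, hQ, hQu⟩, hram⟩ := Place.existsUnique_extension_ramified
      (exists_eq_pullback_add_mul i) hη (hηx ▸ coordFun_last_sq_add i)
    have hstep : ∀ Q : Place (functionField (i + 1)) F,
        Q.comap (pullback (i + 1).zero_le) = P → Q.comap (pullback i.le_succ) = Q₀ :=
      fun Q hQ => huniq _ (by beta_reduce; rw [comap_pullback_pullback, hQ])
    refine ⟨⟨Q, ?_, fun Q' hQ' => hQu Q' (hstep Q' hQ')⟩, fun Q hQ => ?_⟩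
    · beta_reduce
      rw [← comap_pullback_pullback i.zero_le i.le_succ, hQ, hQ₀]
    obtain rfl := hstep Q hQ
    obtain ⟨hunif, v, d, hd, hv, hηv⟩ := hram Q rfl
    refine ⟨_, hunif, ?_, fun j hj => ?_, v ^ 2 ^ i * pullback i.le_succ w, d ^ 2 ^ i * c,
      mul_ne_zero (pow_ne_zero _ hd) hc, (hv.pow _).mul hw, ?_⟩
    -- The new uniformizer is `1/xᵢ₊₁`, and `z + 1 + 1/z` is invariant under inversion; this keeps
    -- the induction going.
    · rw [one_div, inv_inv, one_div]
      ring
    · induction j using Fin.lastCases with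
      | last => exact Place.not_val_of_ramified hη (hηx ▸ coordFun_last_sq_add i) rfl
      | cast j =>
        have hj0 : j ≠ 0 := by
          rintro rfl
          exact hj rfl
        intro c hc
        refine hcoord j hj0 c ?_
        rwa [Place.val_comap, pullback_coordFun]
    · rw [← pullback_pullback i.zero_le i.le_succ, hπη, map_mul, map_pow, hηv, mul_pow, ← pow_mul, pow_succ' 2 i, mul_assoc]

/-- At the `𝔽₂`-valued place of level `i` above `x₀ = 0`, the right side of the equation has a
simple pole, which `y² + y` cannot have. -/
theorem coordFun_last_notMem_range (i : ℕ) :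
    coordFun (i + 1) (Fin.last _) ∉ (pullback i.le_succ).range := by
  have hrat := isRationalFunctionField_zero
  obtain ⟨P, hP, -⟩ := hrat.existsUnique (RingHom.id (ZMod 2)) 0
  obtain ⟨⟨Q, hQ, -⟩, h⟩ := existsUnique_place_of_ramified (hrat.isUniformizer (RingHom.id _) hP)
    rfl i
  obtain ⟨η, hη, hηx, -⟩ := h Q hQ
  rintro ⟨y, hy⟩
  refine hη.sq_add_self_ne y ((pullback i.le_succ).injective ?_)
  rw [hηx, ← coordFun_last_sq_add, map_add, map_pow, hy]

theorem coverDegree_succ (i : ℕ) : coverDegree i (i + 1) = 2 := by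
  have hle := functionField_mono i.le_succ
  rw [coverDegree, IntermediateField.relfinrank_eq_finrank_of_le hle]
  have hy := coordFun_last_notMem_range i
  let y : IntermediateField.extendScalars hle :=
    ⟨x (i + 1), (coordFun (i + 1) (Fin.last _)).2⟩
  have hli : LinearIndependent (functionField i) ![1, y] := by
    rw [LinearIndependent.pair_iff]
    intro s t hst
    have hst' : (s : Ambient) * 1 + t * x (i + 1) = 0 := congrArg Subtype.val hst
    have ht : t = 0 := by
      by_contra ht
      refine hy ⟨-s / t, Subtype.ext ?_⟩
      change ((-s / t : functionField i) : Ambient) = x (i + 1)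
      have ht' : (t : Ambient) ≠ 0 := fun h => ht (Subtype.ext h)
      push_cast
      rw [div_eq_iff ht']
      linear_combination -hst'
    refine ⟨?_, ht⟩
    rw [ht] at hst'
    simpa using hst'
  have hspan : ⊤ ≤ Submodule.span (functionField i) (Set.range ![1, y]) := by
    intro z _
    obtain ⟨a, ha, b, hb, h⟩ := exists_eq_add_mul_x (i := i) z.2
    rw [Matrix.range_cons_cons_empty, Submodule.mem_span_pair]
    refine ⟨⟨a, ha⟩, ⟨b, hb⟩, Subtype.ext ?_⟩
    change a * 1 + b * x (i + 1) = z
    rw [h, mul_one]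
  rw [Module.finrank_eq_card_basis (Module.Basis.mk hli hspan), Fintype.card_fin]

theorem coverDegree_zero (i : ℕ) : coverDegree 0 i = 2 ^ i := by
  induction i with
  | zero => simp [coverDegree]
  | succ i ih =>
    rw [pow_succ, ← ih, ← coverDegree_succ i]
    exact (IntermediateField.relfinrank_mul_relfinrank (functionField_mono i.zero_le)
      (functionField_mono i.le_succ)).symm

end ArtinSchreierTower

/-! ### Finite values in a quadratic step and counting in fibres. -/

theorem Place.exists_val_of_val_sq_add_self {L F : Type*} [Field L] [Field F] {Q : Place L F}
    {y : L} {d : F} (h : Q.Val (y ^ 2 + y) d) : ∃ c, Q.Val y c ∧ c ^ 2 + c = d := by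
  obtain ⟨c, hc⟩ : ∃ c, Q.Val y c := by
    by_cases hy : y = 0
    · exact ⟨0, hy ▸ val_zero⟩
    refine (Q.exists_val_or_val_inv y).resolve_right fun hinv => ?_
    -- At a pole of `y`, the product `(y² + y) y⁻² = 1 + y⁻¹` would have both value `0` and value
    -- `1`.
    have h1 := h.mul (hinv.pow 2)
    have h2 : (y ^ 2 + y) * y⁻¹ ^ 2 = 1 + y⁻¹ := by field_simp
    rw [h2] at h1
    have h3 := h1.unique (val_one.add hinv)
    simp at h3
  exact ⟨c, hc, ((hc.pow 2).add hc).unique h⟩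

/-- The fibers of a composition, when the fibers of the first map have constant cardinality. -/
theorem card_fiber_comp {A B C : Type*} (φ : A → B) (ψ : B → C) (p : C)
    [Finite {b // ψ b = p}] {n : ℕ} (hn : n ≠ 0) (h : ∀ b, ψ b = p → Nat.card {a // φ a = b} = n) :
    Nat.card {a // ψ (φ a) = p} = Nat.card {b // ψ b = p} * n := by
  have := Fintype.ofFinite {b // ψ b = p}
  let e : {a // ψ (φ a) = p} ≃ Σ b : {b // ψ b = p}, {a // φ a = b} :=
    { toFun := fun a => ⟨⟨φ a, a.2⟩, ⟨a, rfl⟩⟩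
      invFun := fun s => ⟨s.2, by rw [s.2.2, s.1.2]⟩
      left_inv := fun _ => rfl
      right_inv := by
        rintro ⟨⟨b, hb⟩, ⟨a, ha⟩⟩
        dsimp only at ha
        subst ha
        rfl }
  have hfib : ∀ b : {b // ψ b = p}, Nat.card {a // φ a = b} = n := fun b => h b b.2
  have hfin : ∀ b : {b // ψ b = p}, Finite {a // φ a = b} := fun b =>
    Nat.finite_of_card_ne_zero (by rwa [hfib b])
  rw [Nat.card_congr e, Nat.card_sigma]
  simp only [hfib]
  rw [Finset.sum_const, Finset.card_univ, ← Nat.card_eq_fintype_card, smul_eq_mul]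

/-! ### The field with eight elements -/

section FieldEight

variable {F : Type*} [Field F]

theorem two_eq_zero_of_card_eq_eight (hF : Nat.card F = 8) : (2 : F) = 0 := by
  have : Finite F := Nat.finite_of_card_ne_zero (by omega)
  have := Fintype.ofFinite F
  have h8 : ((8 : ℕ) : F) = 0 := by
    rw [← hF, Nat.card_eq_fintype_card]
    exact Nat.cast_card_eq_zero F
  have h : (2 : F) ^ 3 = 0 := by rw [← h8]; norm_num
  exact pow_eq_zero_iff (three_ne_zero) |>.mp h

theorem pow_seven_of_card_eq_eight (hF : Nat.card F = 8) {a : F} (ha : a ≠ 0) : a ^ 7 = 1 := by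
  have : Finite F := Nat.finite_of_card_ne_zero (by omega)
  have := Fintype.ofFinite F
  have h := FiniteField.pow_card_sub_one_eq_one a ha
  rwa [← Nat.card_eq_fintype_card, hF] at h

theorem sum_pow_of_card_eq_eight (hF : Nat.card F = 8) {a : F} (ha : a ≠ 0) (ha1 : a ≠ 1) :
    a ^ 6 + a ^ 5 + a ^ 4 + a ^ 3 + a ^ 2 + a + 1 = 0 := by
  have h : (a - 1) * (a ^ 6 + a ^ 5 + a ^ 4 + a ^ 3 + a ^ 2 + a + 1) = 0 := by
    linear_combination pow_seven_of_card_eq_eight hF ha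
  exact (mul_eq_zero.mp h).resolve_left (sub_ne_zero.mpr ha1)

theorem inv_eq_pow_six_of_card_eq_eight (hF : Nat.card F = 8) {a : F} (ha : a ≠ 0) :
    1 / a = a ^ 6 := by
  rw [div_eq_iff ha]
  linear_combination -pow_seven_of_card_eq_eight hF ha

/-- The group `𝔽₈ˣ` has order `7`, prime to `3`. -/
theorem eq_one_of_pow_three_eq_one (hF : Nat.card F = 8) {a : F} (h : a ^ 3 = 1) : a = 1 := by
  have ha : a ≠ 0 := by
    rintro rfl
    simp at h
  linear_combination pow_seven_of_card_eq_eight hF ha - (a ^ 4 + a) * h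

/-- `a + 1 + 1/a` has trace zero over `𝔽₂`, so it is of the form `c² + c`. -/
theorem exists_sq_add_self_eq (hF : Nat.card F = 8) {a : F} (ha : a ≠ 0) (ha1 : a ≠ 1) :
    ∃ c : F, c ^ 2 + c = a + 1 + 1 / a := by
  -- For `t = a + 1 + 1/a`, trace zero reads `t⁴ + t² + t = 0`, so `c = t²` is a root in
  -- characteristic two.
  refine ⟨(a + 1 + 1 / a) ^ 2, ?_⟩
  have h2 := two_eq_zero_of_card_eq_eight hF
  have : CharP F 2 := CharTwo.of_one_ne_zero_of_two_eq_zero one_ne_zero h2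
  have h7 := pow_seven_of_card_eq_eight hF ha
  have hs := sum_pow_of_card_eq_eight hF ha ha1
  rw [inv_eq_pow_six_of_card_eq_eight hF ha]
  simp only [CharTwo.add_sq]
  linear_combination hs + (a ^ 17 + a ^ 10 + a ^ 3 + a ^ 5) * h7 - (a ^ 6 + a) * h2

/-- A value `c` in `𝔽₂` would give `a² + a + 1 = 0`, hence `a³ = 1` and `a = 1`. -/
theorem ne_zero_and_ne_one_of_sq_add_self (hF : Nat.card F = 8) {a c : F} (ha : a ≠ 0)
    (ha1 : a ≠ 1) (hc : c ^ 2 + c = a + 1 + 1 / a) : c ≠ 0 ∧ c ≠ 1 := by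
  have h2 := two_eq_zero_of_card_eq_eight hF
  have h : c ^ 2 + c ≠ 0 := by
    intro h0
    rw [h0] at hc
    field_simp at hc
    exact ha1 (eq_one_of_pow_three_eq_one hF (by linear_combination (1 - a) * hc))
  constructor
  · rintro rfl
    simp at h
  · rintro rfl
    exact h (by linear_combination h2)

/-- The right side is `1`, so a solution would be a primitive cube root of unity. This excludes
points above `x₀ = 1`. -/
theorem sq_add_self_ne_of_card_eq_eight (hF : Nat.card F = 8) (c : F) :
    c ^ 2 + c ≠ 1 + 1 + 1 / 1 := by
  intro h
  have h2 := two_eq_zero_of_card_eq_eight hF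
  have h3 : c ^ 3 = 1 := by
    linear_combination (c - 1) * h + (2 * c - 2) * h2
  have := eq_one_of_pow_three_eq_one hF h3
  rw [this] at h
  have h1 : (1 : F) = 0 := by linear_combination -h
  exact one_ne_zero h1

end FieldEight

namespace ArtinSchreierTower

variable {F : Type*} [Field F]

/-! ### The completely split part of the tower -/

theorem exists_val_coordFun_last {i : ℕ} {Q : Place (functionField (i + 1)) F} {a : F}
    (ha : (Q.comap (pullback i.le_succ)).Val (coordFun i (Fin.last i)) a) (ha0 : a ≠ 0) :
    ∃ c, Q.Val (coordFun (i + 1) (Fin.last _)) c ∧ c ^ 2 + c = a + 1 + 1 / a := by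
  refine Place.exists_val_of_val_sq_add_self ?_
  rw [coordFun_last_sq_add, ← Place.val_comap, one_div, one_div]
  exact (ha.add Place.val_one).add (ha.inv ha0)

theorem card_extension_split (hF : Nat.card F = 8) {i : ℕ} {P : Place (functionField i) F} {a : F}
    (ha : P.Val (coordFun i (Fin.last i)) a) (ha0 : a ≠ 0) (ha1 : a ≠ 1) :
    Nat.card {Q : Place (functionField (i + 1)) F // Q.comap (pullback i.le_succ) = P} = 2 := by
  have h2 := two_eq_zero_of_card_eq_eight hF
  obtain ⟨c, hc⟩ := exists_sq_add_self_eq hF ha0 ha1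
  have hu : P.Val (coordFun i (Fin.last i) + 1 + 1 / coordFun i (Fin.last i)) (a + 1 + 1 / a) := by
    rw [one_div, one_div]
    exact (ha.add Place.val_one).add (ha.inv ha0)
  have hext : ∀ d : F, d ^ 2 + d = a + 1 + 1 / a →
      ∃! Q : Place (functionField (i + 1)) F, Q.comap (pullback i.le_succ) = P ∧
        Q.Val (coordFun (i + 1) (Fin.last _)) d := fun d hd =>
    Place.existsUnique_extension_split (exists_eq_pullback_add_mul i)
      (coordFun_last_notMem_range i) hu (coordFun_last_sq_add i) hd (by simp [h2])
  obtain ⟨Q, ⟨hQ, hQc⟩, hQu⟩ := hext c hc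
  -- In characteristic two the other root is `c + 1`.
  obtain ⟨Q', ⟨hQ', hQc'⟩, hQu'⟩ := hext (c + 1) (by linear_combination hc + (c + 1) * h2)
  have hne : Q ≠ Q' := by
    rintro rfl
    simpa using hQc.unique hQc'
  have hset : {R : Place (functionField (i + 1)) F | R.comap (pullback i.le_succ) = P} =
      {Q, Q'} := by
    ext R
    simp only [Set.mem_ofPred_eq, Set.mem_insert_iff, Set.mem_singleton_iff]
    constructor
    · intro hR
      obtain ⟨d, hd, hda⟩ := exists_val_coordFun_last (Q := R) (hR ▸ ha) ha0
      have hdc : (d - c) * (d - (c + 1)) = 0 := by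
        linear_combination hda - hc + (c - d) * (c + 1) * h2
      rcases mul_eq_zero.mp hdc with h | h
      · exact Or.inl (hQu R ⟨hR, sub_eq_zero.mp h ▸ hd⟩)
      · exact Or.inr (hQu' R ⟨hR, sub_eq_zero.mp h ▸ hd⟩)
    · rintro (rfl | rfl)
      · exact hQ
      · exact hQ'
  change Nat.card ({R : Place (functionField (i + 1)) F | R.comap (pullback i.le_succ) = P}) = 2
  rw [hset, Nat.card_coe_set_eq, Set.ncard_pair hne]

/-- The second conjunct is what the induction needs: the last coordinate stays outside `𝔽₂`, so the
next step splits too. -/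
theorem card_places_over_split (hF : Nat.card F = 8) {P : Place (functionField 0) F} {a : F}
    (ha : P.Val (coordFun 0 0) a) (ha0 : a ≠ 0) (ha1 : a ≠ 1) (i : ℕ) :
    Nat.card {Q : Place (functionField i) F // Q.comap (pullback i.zero_le) = P} = 2 ^ i ∧
    ∀ Q : Place (functionField i) F, Q.comap (pullback i.zero_le) = P →
      ∃ c, c ≠ 0 ∧ c ≠ 1 ∧ Q.Val (coordFun i (Fin.last i)) c := by
  induction i with
  | zero =>
    simp only [comap_pullback_self]
    refine ⟨by simp, ?_⟩
    rintro Q rfl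
    exact ⟨a, ha0, ha1, ha⟩
  | succ i ih =>
    obtain ⟨hcard, hval⟩ := ih
    constructor
    · have hfin : Finite {Q : Place (functionField i) F // Q.comap (pullback i.zero_le) = P} :=
        Nat.finite_of_card_ne_zero (by rw [hcard]; positivity)
      simp only [← comap_pullback_pullback i.zero_le i.le_succ]
      rw [card_fiber_comp (Place.comap (pullback i.le_succ)) (Place.comap (pullback i.zero_le)) P
        two_ne_zero fun R hR => ?_, hcard, pow_succ]
      obtain ⟨c, hc0, hc1, hc⟩ := hval R hR
      exact card_extension_split hF hc hc0 hc1
    · intro Q hQ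
      obtain ⟨c, hc0, hc1, hc⟩ := hval (Q.comap (pullback i.le_succ))
        (by rw [comap_pullback_pullback]; exact hQ)
      obtain ⟨d, hd, hdc⟩ := exists_val_coordFun_last hc hc0
      have := ne_zero_and_ne_one_of_sq_add_self hF hc0 hc1 hdc
      exact ⟨d, this.1, this.2, hd⟩

/-! ### Rational points and places -/

namespace RationalPoint

/-- The place of the function field given by a rational point. -/
def toPlace {i : ℕ} (P : RationalPoint i F) : Place (functionField i) F :=
  ⟨P.localRing, P.eval, P.isLocalHom_eval⟩

/-- The rational points over a finite field are the places of the function field. -/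
def equivPlace (i : ℕ) (F : Type*) [Field F] [Finite F] :
    RationalPoint i F ≃ Place (functionField i) F where
  toFun := toPlace
  invFun P := ⟨⟨P.ring, P.ring_ne_top⟩, P.eval, P.isLocalHom_eval⟩
  left_inv _ := rfl
  right_inv _ := rfl

theorem toPlace_injective {i : ℕ} : Function.Injective (toPlace (F := F) (i := i)) := by
  rintro ⟨⟨O, hO⟩, e, he⟩ ⟨⟨O', hO'⟩, e', he'⟩ h
  simp only [toPlace, Place.mk.injEq] at h
  obtain ⟨rfl, h⟩ := h
  obtain rfl := eq_of_heq h
  rfl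

theorem toPlace_proj {l i : ℕ} (h : l ≤ i) (Q : RationalPoint i F) :
    (Q.proj h).toPlace = Q.toPlace.comap (pullback h) := rfl

theorem coord_eq_coe_iff {i : ℕ} (P : RationalPoint i F) (j : Fin (i + 1)) (c : F) :
    P.coord j = (c : OnePoint F) ↔ P.toPlace.Val (coordFun i j) c := by
  rw [coord]
  split_ifs with h
  · rw [OnePoint.coe_eq_coe]
    exact ⟨fun hc => ⟨h, hc⟩, fun ⟨_, hc⟩ => hc⟩
  · exact ⟨fun hc => absurd hc (OnePoint.infty_ne_coe c), fun ⟨hc, _⟩ => absurd hc h⟩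

theorem coord_eq_infty_iff {i : ℕ} (P : RationalPoint i F) (j : Fin (i + 1)) :
    P.coord j = OnePoint.infty ↔ ∀ c, ¬ P.toPlace.Val (coordFun i j) c := by
  rw [coord]
  split_ifs with h
  · exact ⟨fun hc => absurd hc (OnePoint.coe_ne_infty _), fun hc => absurd ⟨h, rfl⟩ (hc _)⟩
  · exact ⟨fun _ c hc => h hc.1, fun _ => rfl⟩

theorem ramificationIdx_eq {i : ℕ} (Q : RationalPoint i F) {π : functionField 0}
    {η : functionField i} (hπ : (Q.toPlace.comap (pullback i.zero_le)).IsUniformizer π)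
    (hη : Q.toPlace.IsUniformizer η) {e : ℕ} {w : functionField i} {c : F} (hc : c ≠ 0)
    (hw : Q.toPlace.Val w c) (h : pullback i.zero_le π = η ^ e * w) :
    Q.toClosedPoint.ramificationIdx i.zero_le = e := by
  have hmaxη : IsLocalRing.maximalIdeal Q.localRing = Ideal.span {⟨η, hη.val.1⟩} :=
    hη.maximalIdeal_eq
  have hmaxπ : IsLocalRing.maximalIdeal (Q.toClosedPoint.proj i.zero_le).localRing =
      Ideal.span {⟨π, hπ.val.1⟩} := hπ.maximalIdeal_eq
  let _ : Algebra (Q.toClosedPoint.proj i.zero_le).localRing Q.localRing :=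
    (Q.toClosedPoint.localMap i.zero_le).toAlgebra
  have hmap : algebraMap (Q.toClosedPoint.proj i.zero_le).localRing Q.localRing ⟨π, hπ.val.1⟩ =
      ⟨η, hη.val.1⟩ ^ e * ⟨w, hw.1⟩ := Subtype.ext h
  refine Ideal.ramificationIdx'_spec ?_ ?_
  · rw [hmaxπ, hmaxη, Ideal.map_span, Set.image_singleton, hmap, Ideal.span_singleton_pow,
      Ideal.span_singleton_le_span_singleton]
    exact dvd_mul_right _ _
  · rw [hmaxπ, hmaxη, Ideal.map_span, Set.image_singleton, hmap, Ideal.span_singleton_pow,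
      Ideal.span_singleton_le_span_singleton]
    -- If `π` lay in the power `e + 1` of the maximal ideal, the unit `w` would be divisible by `η`
    -- and so have value `0`.
    rintro ⟨v, hv⟩
    have hv' : η ^ e * w = η ^ (e + 1) * v := congrArg Subtype.val hv
    rw [pow_succ, mul_assoc] at hv'
    have hwv := mul_left_cancel₀ (pow_ne_zero e hη.ne_zero) hv'
    have h0 := hη.val.mul (Q.toPlace.val_coe v)
    rw [zero_mul] at h0
    rw [hwv] at hw
    exact hc (hw.unique h0)

end RationalPoint

end ArtinSchreierTower

namespace ArtinSchreierTower

variable {F : Type*} [Field F]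

/-! ### Counting rational points by the value of `x₀`. -/

namespace RationalPoint

theorem coord_zero_eq_coe_iff {i : ℕ} (Q : RationalPoint i F) (a : F) :
    Q.coord 0 = (a : OnePoint F) ↔
      (Q.toPlace.comap (pullback i.zero_le)).Val (coordFun 0 0) a := by
  rw [coord_eq_coe_iff, Place.val_comap, pullback_coordFun]
  rfl

theorem coord_zero_eq_infty_iff {i : ℕ} (Q : RationalPoint i F) :
    Q.coord 0 = OnePoint.infty ↔
      (Q.toPlace.comap (pullback i.zero_le)).Val (coordFun 0 0)⁻¹ 0 := by
  have hx := isRationalFunctionField_zero.ne_zero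
  constructor
  · intro h
    refine (Place.exists_val_or_val_inv _ _).resolve_left fun ⟨c, hc⟩ => ?_
    rw [(Q.coord_zero_eq_coe_iff c).mpr hc] at h
    exact OnePoint.coe_ne_infty c h
  · intro h
    by_contra hne
    obtain ⟨c, hc⟩ := OnePoint.ne_infty_iff_exists.mp hne
    have := ((Q.coord_zero_eq_coe_iff c).mp hc.symm).mul h
    rw [mul_inv_cancel₀ hx, mul_zero] at this
    exact zero_ne_one (this.unique Place.val_one)

theorem coord_zero_ne_one (hF : Nat.card F = 8) {i : ℕ} (hi : 1 ≤ i) (Q : RationalPoint i F) :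
    Q.coord 0 ≠ ((1 : F) : OnePoint F) := by
  intro h
  rw [coord_zero_eq_coe_iff, ← comap_pullback_pullback (Nat.le_succ 0) hi] at h
  obtain ⟨c, -, hc⟩ := exists_val_coordFun_last h one_ne_zero
  exact sq_add_self_ne_of_card_eq_eight hF c hc

theorem exists_isTotallyRamified [Finite F] {P : Place (functionField 0) F} {π : functionField 0}
    (hπ : P.IsUniformizer π) (hπx : π + 1 + 1 / π = coordFun 0 0 + 1 + 1 / coordFun 0 0) (i : ℕ) :
    ∃ Q : RationalPoint i F,
      (∀ Q' : RationalPoint i F, Q'.toPlace.comap (pullback i.zero_le) = P ↔ Q' = Q) ∧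
      (∀ j, j ≠ 0 → Q.coord j = OnePoint.infty) ∧
      Q.toClosedPoint.IsTotallyRamified i.zero_le := by
  obtain ⟨⟨R, hR, hRu⟩, hprop⟩ := existsUnique_place_of_ramified hπ hπx i
  obtain ⟨Q, rfl⟩ := (equivPlace i F).surjective R
  obtain ⟨η, hη, -, hcoord, w, c, hc, hw, h⟩ := hprop _ hR
  refine ⟨Q, fun Q' => ⟨fun hQ' => toPlace_injective (hRu _ hQ'), ?_⟩,
    fun j hj => (Q.coord_eq_infty_iff j).mpr (hcoord j hj), ?_⟩
  · rintro rfl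
    exact hR
  · rw [ClosedPoint.IsTotallyRamified, coverDegree_zero]
    subst hR
    exact Q.ramificationIdx_eq hπ hη hc hw h

theorem card_over_split (hF : Nat.card F = 8) {a : F} (ha0 : a ≠ 0) (ha1 : a ≠ 1)
    {P : RationalPoint 0 F} (hP : P.coord 0 = (a : OnePoint F)) (i : ℕ) :
    Nat.card {Q : RationalPoint i F // Q.proj i.zero_le = P} = 2 ^ i := by
  have : Finite F := Nat.finite_of_card_ne_zero (by omega)
  rw [coord_eq_coe_iff] at hP
  rw [← (card_places_over_split hF hP ha0 ha1 i).1]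
  refine Nat.card_congr ((equivPlace i F).subtypeEquiv fun Q => ?_)
  rw [← toPlace_injective.eq_iff, toPlace_proj]
  rfl

theorem existsUnique_coord_zero [Finite F] [CharP F 2] (a : F) :
    ∃! P : RationalPoint 0 F, P.coord 0 = (a : OnePoint F) := by
  obtain ⟨R, hR, hRu⟩ := isRationalFunctionField_zero.existsUnique (ZMod.castHom dvd_rfl F) a
  obtain ⟨P, rfl⟩ := (equivPlace 0 F).surjective R
  exact ⟨P, (P.coord_eq_coe_iff 0 a).mpr hR,
    fun P' hP' => toPlace_injective (hRu _ ((P'.coord_eq_coe_iff 0 a).mp hP'))⟩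

theorem card_coord_zero_eq (hF : Nat.card F = 8) {a : F} (ha0 : a ≠ 0) (ha1 : a ≠ 1) (i : ℕ) :
    Nat.card {Q : RationalPoint i F // Q.coord 0 = (a : OnePoint F)} = 2 ^ i := by
  have : Finite F := Nat.finite_of_card_ne_zero (by omega)
  have : CharP F 2 :=
    CharTwo.of_one_ne_zero_of_two_eq_zero one_ne_zero (two_eq_zero_of_card_eq_eight hF)
  obtain ⟨P, hP, hPu⟩ := existsUnique_coord_zero (F := F) a
  rw [← card_over_split hF ha0 ha1 hP i]
  refine Nat.card_congr (Equiv.subtypeEquivRight fun Q => ?_)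
  have hQ : (Q.proj i.zero_le).coord 0 = (a : OnePoint F) ↔ Q.coord 0 = (a : OnePoint F) := by
    rw [Q.coord_zero_eq_coe_iff, coord_eq_coe_iff, toPlace_proj]
  rw [← hQ]
  exact ⟨hPu _, fun h => h ▸ hP⟩

theorem card_eq_of_fibers (hF : Nat.card F = 8) {i : ℕ} (hi : 1 ≤ i) {P₀ P₁ : RationalPoint i F}
    (h₀ : ∀ Q : RationalPoint i F, Q.coord 0 = ((0 : F) : OnePoint F) ↔ Q = P₀)
    (h₁ : ∀ Q : RationalPoint i F, Q.coord 0 = OnePoint.infty ↔ Q = P₁) :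
    Nat.card (RationalPoint i F) = 6 * 2 ^ i + 2 := by
  classical
  have : Finite F := Nat.finite_of_card_ne_zero (by omega)
  have := Fintype.ofFinite F
  let n : Option F → ℕ := fun o => Nat.card {Q : RationalPoint i F // Q.coord 0 = o}
  have hn0 : n (some 0) = 1 := by
    rw [← Nat.card_unique (α := {Q : RationalPoint i F // Q = P₀})]
    exact Nat.card_congr (Equiv.subtypeEquivRight h₀)
  have hninf : n none = 1 := by
    rw [← Nat.card_unique (α := {Q : RationalPoint i F // Q = P₁})]
    exact Nat.card_congr (Equiv.subtypeEquivRight h₁)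
  have hemp : IsEmpty {Q : RationalPoint i F // Q.coord 0 = some (1 : F)} :=
    ⟨fun Q => coord_zero_ne_one hF hi Q.1 Q.2⟩
  have hn1 : n (some 1) = 0 := Nat.card_of_isEmpty
  have hna : ∀ a : F, a ≠ 0 → a ≠ 1 → n (some a) = 2 ^ i := fun a ha0 ha1 =>
    card_coord_zero_eq hF ha0 ha1 i
  -- As `Nat.card` is `0` on infinite types too, a nonzero count gives finiteness, but the fibre
  -- over `1` needs its emptiness.
  have hfin : ∀ o : Option F, Finite {Q : RationalPoint i F // Q.coord 0 = o} := by
    intro o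
    by_cases ho : o = some 1
    · subst ho
      infer_instance
    · refine Nat.finite_of_card_ne_zero ?_
      change n o ≠ 0
      rcases o with _ | a
      · rw [hninf]; exact one_ne_zero
      · by_cases ha : a = 0
        · rw [ha, hn0]; exact one_ne_zero
        · rw [hna a ha fun h => ho (congrArg some h)]; positivity
  have hsum : Nat.card (RationalPoint i F) = ∑ o : Option F, n o := by
    rw [← Nat.card_sigma]
    exact Nat.card_congr
      (Equiv.sigmaFiberEquiv fun Q : RationalPoint i F => (Q.coord 0 : Option F)).symm
  have h1mem : (1 : F) ∈ Finset.univ.erase (0 : F) := by simp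
  rw [hsum, Fintype.sum_option, hninf, ← Finset.add_sum_erase _ _ (Finset.mem_univ (0 : F)), hn0,
    ← Finset.add_sum_erase _ _ h1mem, hn1, Finset.sum_congr rfl fun a ha => hna a ?_ ?_,
    Finset.sum_const, Finset.card_erase_of_mem h1mem, Finset.card_erase_of_mem (Finset.mem_univ _),
    Finset.card_univ, ← Nat.card_eq_fintype_card, hF, smul_eq_mul]
  · ring
  · exact Finset.ne_of_mem_erase (Finset.mem_of_mem_erase ha)
  · exact Finset.ne_of_mem_erase ha

end RationalPoint

end ArtinSchreierTower

/-! ### Assembly of the fibres over `ℙ¹(𝔽₈)`. -/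

theorem mainTheorem3 {F : Type*} [Field F] (hF : Nat.card F = 8) (i : ℕ) (hi : 1 ≤ i) :
    -- the cover `Cᵢ → C₀` has degree `2 ^ i`; the number of `𝔽₈`-rational points of `Cᵢ`
    ArtinSchreierTower.coverDegree 0 i = 2 ^ i ∧
    Nat.card (ArtinSchreierTower.RationalPoint i F) = 6 * 2 ^ i + 2 ∧
    -- the points of `C₀` with `x₀ ∈ 𝔽₈ - 𝔽₂` split completely
    (∀ a : F, a ≠ 0 → a ≠ 1 →
      (∃! P : ArtinSchreierTower.RationalPoint 0 F, P.coord 0 = (a : OnePoint F)) ∧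
      ∀ P : ArtinSchreierTower.RationalPoint 0 F, P.coord 0 = (a : OnePoint F) →
        P.SplitsCompletely (Nat.zero_le i)) ∧
    -- the remaining rational points are `P(0, ∞, …, ∞)` and `P(∞, …, ∞)`
    ∃ P₀ P₁ : ArtinSchreierTower.RationalPoint i F,
      (P₀.coord 0 = ((0 : F) : OnePoint F) ∧ ∀ j, j ≠ 0 → P₀.coord j = OnePoint.infty) ∧
      (∀ j, P₁.coord j = OnePoint.infty) ∧
      P₀.toClosedPoint.IsTotallyRamified (Nat.zero_le i) ∧
      P₁.toClosedPoint.IsTotallyRamified (Nat.zero_le i) ∧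
      ∀ Q : ArtinSchreierTower.RationalPoint i F,
        (¬ ∃ a : F, a ≠ 0 ∧ a ≠ 1 ∧ Q.coord 0 = (a : OnePoint F)) ↔ Q = P₀ ∨ Q = P₁ := by
  have : Finite F := Nat.finite_of_card_ne_zero (by omega)
  have : CharP F 2 :=
    CharTwo.of_one_ne_zero_of_two_eq_zero one_ne_zero (two_eq_zero_of_card_eq_eight hF)
  let g : ZMod 2 →+* F := ZMod.castHom dvd_rfl F
  have hrat := ArtinSchreierTower.isRationalFunctionField_zero
  obtain ⟨R₀, hR₀, hR₀u⟩ := hrat.existsUnique g 0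
  obtain ⟨R₁, hR₁, hR₁u⟩ := hrat.inv.existsUnique g 0
  obtain ⟨P₀, hP₀u, hP₀c, hP₀r⟩ :=
    ArtinSchreierTower.RationalPoint.exists_isTotallyRamified (hrat.isUniformizer g hR₀) rfl i
  obtain ⟨P₁, hP₁u, hP₁c, hP₁r⟩ :=
    -- At infinity the uniformizer is `1/x₀`, and the symmetry of `z + 1 + 1/z` supplies the
    -- required identity.
    ArtinSchreierTower.RationalPoint.exists_isTotallyRamified (hrat.inv.isUniformizer g hR₁)
      (by rw [one_div, inv_inv, one_div]; ring) i
  have h₀ : ∀ Q : ArtinSchreierTower.RationalPoint i F,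
      Q.coord 0 = ((0 : F) : OnePoint F) ↔ Q = P₀ := by
    intro Q
    rw [Q.coord_zero_eq_coe_iff, ← hP₀u]
    exact ⟨hR₀u _, fun h => h ▸ hR₀⟩
  have h₁ : ∀ Q : ArtinSchreierTower.RationalPoint i F, Q.coord 0 = OnePoint.infty ↔ Q = P₁ := by
    intro Q
    rw [Q.coord_zero_eq_infty_iff, ← hP₁u]
    exact ⟨hR₁u _, fun h => h ▸ hR₁⟩
  refine ⟨ArtinSchreierTower.coverDegree_zero i,
    ArtinSchreierTower.RationalPoint.card_eq_of_fibers hF hi h₀ h₁, fun a ha0 ha1 =>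
      ⟨ArtinSchreierTower.RationalPoint.existsUnique_coord_zero a, fun P hP => ?_⟩,
    P₀, P₁, ⟨(h₀ P₀).mpr rfl, hP₀c⟩, fun j => ?_, hP₀r, hP₁r, fun Q => ?_⟩
  · rw [ArtinSchreierTower.RationalPoint.SplitsCompletely, ArtinSchreierTower.coverDegree_zero]
    exact ArtinSchreierTower.RationalPoint.card_over_split hF ha0 ha1 hP i
  · by_cases hj : j = 0
    · rw [hj]
      exact (h₁ P₁).mpr rfl
    · exact hP₁c j hj
  · rw [← h₀, ← h₁]
    constructor
    · intro h
      by_cases hinf : Q.coord 0 = OnePoint.infty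
      · exact Or.inr hinf
      obtain ⟨a, ha⟩ := OnePoint.ne_infty_iff_exists.mp hinf
      by_cases ha0 : a = 0
      · exact Or.inl (by rw [← ha, ha0])
      · refine absurd ⟨a, ha0, ?_, ha.symm⟩ h
        rintro rfl
        exact Q.coord_zero_ne_one hF hi ha.symm
    · rintro h ⟨a, ha0, -, ha⟩
      rw [ha] at h
      rcases h with h | h
      · exact ha0 (OnePoint.coe_injective h)
      · exact OnePoint.coe_ne_infty a h
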